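/- Let $n\ge 2$ and let $\pi_n(z)=(s_1(z),\dots,s_{n-1}(z),p(z))$, where $s_i(z)=\sum_{1\le k_1<\dots<k_i\le n}z_{k_1}\cdots z_{k_i}$ and $p(z)=z_1\cdots z_n$, be the symmetrization map. For $k\ge 1$ (with $\pi_1(z)=z$) put $\Gamma_k=\pi_k(\overline{\mathbb D}^{\,k})$ and $b\Gamma_k=\pi_k(\mathbb T^k)$ (the distinguished boundary of $\Gamma_k$). A commuting $k$-tuple $T$ of bounded operators on a complex Hilbert space is called a $\Gamma_k$-contraction if $\Gamma_k$ is a spectral set for $T$, that is, if the Taylor joint spectrum of $T$ is contained in $\Gamma_k$ and $\|f(T)\|\le\sup_{\Gamma_k}|f|$ for every rational function $f=p/q$ with $p,q$ polynomials and $q$ without zeros in $\Gamma_k$, where $f(T)=p(T)q(T)^{-1}$. It is called a $\Gamma_k$-unitary if it consists of normal operators and its Taylor joint spectrum is contained in $b\Gamma_k$. Theorem. Let $(S_1,\dots,S_{n-1},P)$ be a commuting $n$-tuple of bounded operators on a complex Hilbert space $\mathcal H$. Then the following are equivalent: (1) $(S_1,\dots,S_{n-1},P)$ is a $\Gamma_n$-unitary;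 (2) there exist commuting unitary operators $U_1,\dots,U_n$ on $\mathcal H$ such that $(S_1,\dots,S_{n-1},P)=\pi_n(U_1,\dots,U_n)$; (3) $P$ is unitary, $S_i=S_{n-i}^*P$ for $i=1,\dots,n-1$, and $\left(\frac{n-1}{n}S_1,\frac{n-2}{n}S_2,\dots,\frac1nS_{n-1}\right)$ is a $\Gamma_{n-1}$-contraction; (4) $(S_1,\dots,S_{n-1},P)$ is a $\Gamma_n$-contraction and $P$ is unitary; (5) $P$ is unitary and there exists a $\Gamma_{n-1}$-unitary $(C_1,\dots,C_{n-1})$ on $\mathcal H$ such that $C_1,\dots,C_{n-1}$ commute with $P$ and $S_i=C_i+C_{n-i}^*P$ for $i=1,\dots,n-1$. -/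

import Mathlib

open scoped TensorProduct

noncomputable section

namespace SymPolydisc

/-- The symmetrization map `π_n(z) = (s_1(z), …, s_{n-1}(z), p(z))`: the coordinate with (zero-based)
index `i` is the elementary symmetric polynomial of degree `i + 1` in `z_1, …, z_n`. -/
def symmMap (n : ℕ) (z : Fin n → ℂ) : Fin n → ℂ :=
  fun i => MvPolynomial.eval z (MvPolynomial.esymm (Fin n) ℂ ((i : ℕ) + 1))

/-- The closed symmetrized polydisc `Γ_n`, the image of the closed unit polydisc under `π_n`. -/
def Gam (n : ℕ) : Set (Fin n → ℂ) :=
  symmMap n '' {z | ∀ i, ‖z i‖ ≤ 1}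

/-- The distinguished boundary `bΓ_n`, the image of the `n`-torus under `π_n`. -/
def bGam (n : ℕ) : Set (Fin n → ℂ) :=
  symmMap n '' {z | ∀ i, ‖z i‖ = 1}

section Operators

variable {H : Type*} [NormedAddCommGroup H] [InnerProductSpace ℂ H]

/-- The tuple `T` of bounded operators is commuting. -/
def IsCommuting {n : ℕ} (T : Fin n → H →L[ℂ] H) : Prop :=
  ∀ i j, Commute (T i) (T j)

/-- `p(T)` for a polynomial `p` in `n` variables and an `n`-tuple `T` of operators. Monomials are
evaluated as `T_1^{m_1} ⋯ T_n^{m_n}`; the order is irrelevant for commuting tuples. -/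
def opEval {n : ℕ} (T : Fin n → H →L[ℂ] H) (p : MvPolynomial (Fin n) ℂ) : H →L[ℂ] H :=
  ∑ m ∈ p.support, p.coeff m • (List.ofFn fun i => T i ^ m i).prod

/-- The symmetrization `π_n(U_1, …, U_n)` of a tuple of operators. -/
def opSymmMap {n : ℕ} (U : Fin n → H →L[ℂ] H) : Fin n → H →L[ℂ] H :=
  fun i => opEval U (MvPolynomial.esymm (Fin n) ℂ ((i : ℕ) + 1))

/-- The Koszul operator `D_T = ∑ i, T_i ⊗ E_i` on `H ⊗ Λ`, where `Λ` is the exterior algebra on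
generators `e_1, …, e_n` and `E_i ξ = e_i ξ` is the creation operator. -/
def koszulMap {n : ℕ} (T : Fin n → H →L[ℂ] H) :
    (H ⊗[ℂ] ExteriorAlgebra ℂ (Fin n → ℂ)) →ₗ[ℂ] (H ⊗[ℂ] ExteriorAlgebra ℂ (Fin n → ℂ)) :=
  ∑ i, TensorProduct.map (T i : H →ₗ[ℂ] H)
    (LinearMap.mulLeft ℂ (ExteriorAlgebra.ι ℂ (Pi.single i (1 : ℂ) : Fin n → ℂ)))

/-- The tuple `T` is non-singular: its Koszul complex is exact. -/
def IsNonsingular {n : ℕ} (T : Fin n → H →L[ℂ] H) : Prop :=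
  LinearMap.range (koszulMap T) = LinearMap.ker (koszulMap T)

/-- The Taylor joint spectrum of a commuting tuple `T`. -/
def taylorSpectrum {n : ℕ} (T : Fin n → H →L[ℂ] H) : Set (Fin n → ℂ) :=
  {l | ¬ IsNonsingular fun i => T i - l i • (1 : H →L[ℂ] H)}

/-- The compact set `X ⊆ ℂⁿ` is a spectral set for the tuple `T`: the Taylor joint spectrum of `T`
lies in `X`, and `‖f(T)‖ ≤ ‖f‖_{∞,X}` for every quotient `f = p / q` of polynomials such that `q`
has no zeros in `X`, where `f(T) = p(T) q(T)⁻¹`. (The invertibility of `q(T)`, automatic because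
the Taylor joint spectrum lies in `X`, is recorded so that the inverse below is a genuine one.) -/
structure IsSpectralSet {n : ℕ} (X : Set (Fin n → ℂ)) (T : Fin n → H →L[ℂ] H) : Prop where
  spectrum_subset : taylorSpectrum T ⊆ X
  norm_le : ∀ p q : MvPolynomial (Fin n) ℂ, (∀ x ∈ X, MvPolynomial.eval x q ≠ 0) →
    IsUnit (opEval T q) ∧
    ‖opEval T p * Ring.inverse (opEval T q)‖ ≤
      ⨆ x : X, ‖MvPolynomial.eval (x : Fin n → ℂ) p / MvPolynomial.eval (x : Fin n → ℂ) q‖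

/-- A `Γ_n`-contraction: a commuting tuple having `Γ_n` as a spectral set. -/
structure IsGamContraction {n : ℕ} (T : Fin n → H →L[ℂ] H) : Prop where
  commuting : IsCommuting T
  spectralSet : IsSpectralSet (Gam n) T

/-- A `Γ_n`-unitary: a commuting tuple of normal operators with Taylor joint spectrum in `bΓ_n`. -/
structure IsGamUnitary [CompleteSpace H] {n : ℕ} (T : Fin n → H →L[ℂ] H) : Prop where
  commuting : IsCommuting T
  normal : ∀ i, IsStarNormal (T i)
  spectrum_subset : taylorSpectrum T ⊆ bGam n

/-- The tuple `(S_1, …, S_m, P)`. -/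
def tuple {m : ℕ} (S : Fin m → H →L[ℂ] H) (P : H →L[ℂ] H) : Fin (m + 1) → H →L[ℂ] H :=
  Fin.snoc (α := fun _ => H →L[ℂ] H) S P

end Operators

end SymPolydisc

end

noncomputable section

namespace SymPolydisc

/-! Most of the theorem reduces to scalars. Commuting normal operators have a commutative
bicommutant, by Fuglede's theorem. It is a C⋆-algebra `A` acting isometrically on `H`, and by
`taylorSpectrum_eq_range` the Taylor spectrum of a tuple from `A` is its set of values at the
characters of `A`. Identities and spectral inclusions then become statements about points of Γ_n and
bΓ_n.

A point of ℂⁿ is the signed coefficient vector of a monic polynomial of degree n. It lies in Γ_n (in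
bΓ_n) when all roots lie in the closed disc (on the circle). On bΓ_n one has s_i = conj(s_{n-i}) p:
the polynomial is self-inversive. The weighted tuple belongs to its derivative divided by n, so
Gauss–Lucas (`derivTuple_mem_Gam`) and Cohn's criterion (`mem_bGam_of_derivTuple_mem_Gam`) handle
the condition on Γ_{n-1}. Splitting off one root gives s_i = c_i + conj(c_{n-i}) p, with c the
symmetrization of the other roots; this is the condition on (C_1, …, C_{n-1}).

Two implications need more than pointwise arguments. To write a Γ_n-unitary as a symmetrization of
unitaries, the roots must depend continuously on the character. This works because the character
space of a bicommutant is extremally disconnected, hence projective among compact Hausdorff spaces,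
so the joint value map lifts through the torus. For a Γ_n-contraction with unitary P, normality is
not known beforehand: von Neumann's inequality for rational functions (cα p - s_{n-i}) / (c - α
s_i), of modulus at most one on Γ_n, forces S_i = S_{n-i}^* P, and normality follows. -/

/-! ### Points of ℂⁿ as monic polynomials. -/

open Polynomial in
/-- The monic polynomial `X^n - x_1 X^{n-1} + x_2 X^{n-2} - ⋯`. -/
def symmPoly (n : ℕ) (x : Fin n → ℂ) : ℂ[X] :=
  X ^ n + ∑ i : Fin n, C ((-1) ^ ((i : ℕ) + 1) * x i) * X ^ (n - 1 - (i : ℕ))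

open Polynomial in
theorem symmPoly_symmMap (n : ℕ) (z : Fin n → ℂ) :
    symmPoly n (symmMap n z) = ∏ j, (X - C (z j)) := by
  have h := Multiset.prod_X_sub_X_eq_sum_esymm (Finset.univ.val.map z)
  rw [Multiset.map_map] at h
  change ∏ j, (X - C (z j)) = _ at h
  rw [h, Multiset.card_map, Finset.card_val, Finset.card_univ, Fintype.card_fin,
    Finset.sum_range_succ', ← Fin.sum_univ_eq_sum_range
      (fun k => (-1) ^ (k + 1) * (C ((Finset.univ.val.map z).esymm (k + 1)) * X ^ (n - (k + 1))))]
  simp only [symmPoly, symmMap]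
  rw [add_comm]
  congr 1
  · refine Finset.sum_congr rfl fun i _ => ?_
    have := MvPolynomial.aeval_esymm_eq_multiset_esymm (Fin n) ℂ ((i : ℕ) + 1) z
    rw [← this, MvPolynomial.aeval_eq_eval, C_mul, C_pow, C_neg, C_1, mul_assoc, add_comm (i : ℕ) 1,
      Nat.sub_add_eq]
  · simp [Multiset.esymm]

open Polynomial in
theorem degree_symmPoly_sum_lt (n : ℕ) (x : Fin n → ℂ) :
    (∑ i : Fin n, C ((-1) ^ ((i : ℕ) + 1) * x i) * X ^ (n - 1 - (i : ℕ))).degree <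
      (n : WithBot ℕ) := by
  rw [← mem_degreeLT]
  refine Submodule.sum_mem _ fun i _ => mem_degreeLT.2 ?_
  refine lt_of_le_of_lt (degree_C_mul_X_pow_le _ _) ?_
  have := i.2
  exact_mod_cast (by omega : n - 1 - (i : ℕ) < n)

open Polynomial in
theorem symmPoly_monic (n : ℕ) (x : Fin n → ℂ) : (symmPoly n x).Monic :=
  monic_X_pow_add (degree_symmPoly_sum_lt n x)

open Polynomial in
theorem symmPoly_natDegree (n : ℕ) (x : Fin n → ℂ) : (symmPoly n x).natDegree = n := by
  refine natDegree_eq_of_degree_eq_some ?_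
  have := degree_add_eq_left_of_degree_lt (p := (X : ℂ[X]) ^ n)
    (lt_of_lt_of_eq (degree_symmPoly_sum_lt n x) (degree_X_pow n).symm)
  rw [symmPoly, this, degree_X_pow]

open Polynomial in
theorem symmPoly_coeff (n : ℕ) (x : Fin n → ℂ) (i : Fin n) :
    (symmPoly n x).coeff (n - 1 - (i : ℕ)) = (-1) ^ ((i : ℕ) + 1) * x i := by
  have hi := i.2
  rw [symmPoly, coeff_add, coeff_X_pow, if_neg (by omega), zero_add, finsetSum_coeff,
    Finset.sum_eq_single i]
  · rw [coeff_C_mul, coeff_X_pow, if_pos rfl, mul_one]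
  · intro j _ hj
    have hj2 := j.2
    have : (j : ℕ) ≠ i := fun h => hj (Fin.ext h)
    rw [coeff_C_mul, coeff_X_pow, if_neg (by omega), mul_zero]
  · simp

theorem symmPoly_injective (n : ℕ) : Function.Injective (symmPoly n) := by
  intro x y h
  funext i
  have := symmPoly_coeff n x i
  rw [h, symmPoly_coeff] at this
  exact (mul_left_cancel₀ (pow_ne_zero _ (by norm_num)) this).symm

open Polynomial in
theorem exists_symmMap_eq (n : ℕ) (x : Fin n → ℂ) : ∃ z, symmMap n z = x := by
  have hs : (symmPoly n x).roots.card = n := by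
    rw [IsAlgClosed.card_roots_eq_natDegree, symmPoly_natDegree]
  obtain ⟨l, hl⟩ := Quot.exists_rep (symmPoly n x).roots
  have hlen : l.length = n := by
    rw [← hs, ← hl]; rfl
  subst hlen
  refine ⟨l.get, symmPoly_injective _ ?_⟩
  rw [symmPoly_symmMap]
  have h := (IsAlgClosed.splits (symmPoly l.length x)).eq_prod_roots_of_monic (symmPoly_monic _ x)
  rw [h, ← hl]
  change _ = (Multiset.map (fun a => X - C a) (l : Multiset ℂ)).prod
  rw [Multiset.map_coe, Multiset.prod_coe, ← List.prod_ofFn]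
  congr 1
  conv_rhs => rw [← List.ofFn_get l]
  rw [List.map_ofFn]; rfl

/-- Turns membership in Γ_n (`p` is ‖w‖ ≤ 1) and bΓ_n (`p` is ‖w‖ = 1) into root location. Both
directions rest on `symmPoly_symmMap`; the converse also uses that ℂ is algebraically closed. -/
theorem mem_symmMap_image_iff (n : ℕ) (x : Fin n → ℂ) (p : ℂ → Prop) :
    x ∈ symmMap n '' {z | ∀ j, p (z j)} ↔ ∀ w, (symmPoly n x).eval w = 0 → p w := by
  have key : ∀ z : Fin n → ℂ, ∀ w,
      (symmPoly n (symmMap n z)).eval w = 0 ↔ ∃ j, z j = w := by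
    intro z w
    rw [symmPoly_symmMap, Polynomial.eval_prod, Finset.prod_eq_zero_iff]
    simp [sub_eq_zero, eq_comm]
  constructor
  · rintro ⟨z, hz, rfl⟩ w hw
    obtain ⟨j, rfl⟩ := (key z w).1 hw
    exact hz j
  · intro h
    obtain ⟨z, rfl⟩ := exists_symmMap_eq n x
    exact ⟨z, fun j => h _ ((key z _).2 ⟨j, rfl⟩), rfl⟩

/-! ### Elementary symmetric functions on the torus; Γ_n and bΓ_n. -/

/-- The value at `z` of the elementary symmetric polynomial of degree `k`. -/
def esymmVal (n k : ℕ) (z : Fin n → ℂ) : ℂ :=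
  MvPolynomial.eval z (MvPolynomial.esymm (Fin n) ℂ k)

theorem esymmVal_eq (n k : ℕ) (z : Fin n → ℂ) :
    esymmVal n k z = ∑ t ∈ Finset.powersetCard k Finset.univ, ∏ i ∈ t, z i := by
  simp [esymmVal, MvPolynomial.esymm]

theorem esymmVal_self (n : ℕ) (z : Fin n → ℂ) : esymmVal n n z = ∏ i, z i := by
  have : Finset.powersetCard n (Finset.univ : Finset (Fin n)) = {Finset.univ} := by
    simpa using Finset.powersetCard_self (Finset.univ : Finset (Fin n))
  rw [esymmVal_eq, this, Finset.sum_singleton]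

theorem symmMap_apply (n : ℕ) (z : Fin n → ℂ) (i : Fin n) :
    symmMap n z i = esymmVal n ((i : ℕ) + 1) z := rfl

theorem symmMap_last (n : ℕ) (z : Fin (n + 1) → ℂ) :
    symmMap (n + 1) z (Fin.last n) = ∏ i, z i := by
  rw [symmMap_apply, Fin.val_last, esymmVal_self]

theorem conj_mul_self_of_norm_eq_one {z : ℂ} (hz : ‖z‖ = 1) : (starRingEnd ℂ) z * z = 1 := by
  rw [mul_comm, Complex.mul_conj, Complex.normSq_eq_norm_sq, hz]; norm_num

/-- Pair each k-subset with its complement: for unimodular numbers, the product over `t` is the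
conjugate of the product over `tᶜ` times the full product. -/
theorem esymmVal_conj (n k : ℕ) (hk : k ≤ n) (z : Fin n → ℂ) (hz : ∀ i, ‖z i‖ = 1) :
    esymmVal n k z = (starRingEnd ℂ) (esymmVal n (n - k) z) * ∏ i, z i := by
  classical
  rw [esymmVal_eq, esymmVal_eq, map_sum, Finset.sum_mul]
  refine Finset.sum_bij' (fun t _ => tᶜ) (fun t _ => tᶜ) ?_ ?_ ?_ ?_ ?_
  · intro t ht
    rw [Finset.mem_powersetCard_univ] at ht ⊢
    rw [Finset.card_compl, ht, Fintype.card_fin]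
  · intro t ht
    rw [Finset.mem_powersetCard_univ] at ht ⊢
    rw [Finset.card_compl, ht, Fintype.card_fin]; omega
  · intro t _; exact compl_compl t
  · intro t _; exact compl_compl t
  · intro t _
    rw [← Finset.prod_compl_mul_prod t, ← mul_assoc, map_prod, ← Finset.prod_mul_distrib,
      Finset.prod_congr rfl fun i _ => conj_mul_self_of_norm_eq_one (hz i)]
    simp

theorem esymmVal_succ_snoc (n k : ℕ) (z : Fin n → ℂ) (a : ℂ) :
    esymmVal (n + 1) (k + 1) (Fin.snoc z a) = esymmVal n (k + 1) z + a * esymmVal n k z := by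
  have key : ∀ (n k : ℕ) (z : Fin n → ℂ), esymmVal n k z = (Finset.univ.val.map z).esymm k := by
    intro n k z
    rw [← MvPolynomial.aeval_esymm_eq_multiset_esymm (Fin n) ℂ k z, MvPolynomial.aeval_eq_eval]
    rfl
  have hm : (Finset.univ : Finset (Fin (n + 1))).val.map (Fin.snoc z a : Fin (n + 1) → ℂ)
      = a ::ₘ Finset.univ.val.map z := by
    rw [Fin.univ_castSuccEmb]
    simp [Function.comp_def]
  rw [key, key, key, hm]
  simp only [Multiset.esymm, Multiset.powersetCard_cons, Multiset.map_add, Multiset.sum_add,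
    Multiset.map_map, Function.comp_def, Multiset.prod_cons, Multiset.sum_map_mul_left]

/-- Scalar model of S_i = C_i + C_{n-i}^* P: a subset either omits the last variable or contains it,
and `esymmVal_conj` rewrites the second contribution. Only the first m variables need modulus one.
-/
theorem symmMap_snoc_castSucc (m : ℕ) (z : Fin m → ℂ) (hz : ∀ i, ‖z i‖ = 1) (a : ℂ) (i : Fin m) :
    symmMap (m + 1) (Fin.snoc z a) i.castSucc =
      symmMap m z i + (starRingEnd ℂ) (symmMap m z i.rev) * ((∏ j, z j) * a) := by
  have hi := i.2
  have h2 : m - (m - (↑i + 1) + 1) = (i : ℕ) := by omega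
  have h1 := esymmVal_conj m i hi.le z hz
  rw [symmMap_apply, symmMap_apply, symmMap_apply, Fin.val_castSucc, esymmVal_succ_snoc, Fin.val_rev,
    h1, show m - (↑i + 1) + 1 = m - (i : ℕ) by omega]
  ring

theorem symmMap_snoc_last (m : ℕ) (z : Fin m → ℂ) (a : ℂ) :
    symmMap (m + 1) (Fin.snoc z a) (Fin.last m) = (∏ j, z j) * a := by
  rw [symmMap_last, Fin.prod_univ_castSucc]
  simp

/-- On the distinguished boundary `s_i = conj (s_{n-i}) p`. -/
theorem bGam_castSucc {m : ℕ} {x : Fin (m + 1) → ℂ} (hx : x ∈ bGam (m + 1)) (i : Fin m) :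
    x i.castSucc = (starRingEnd ℂ) (x i.rev.castSucc) * x (Fin.last m) := by
  obtain ⟨z, hz, rfl⟩ := hx
  have hi := i.2
  rw [symmMap_last, symmMap_apply, symmMap_apply, Fin.val_castSucc, Fin.val_castSucc, Fin.val_rev,
    esymmVal_conj (m + 1) (i + 1) (by omega) z hz]
  congr 4
  omega

theorem norm_last_bGam {m : ℕ} {x : Fin (m + 1) → ℂ} (hx : x ∈ bGam (m + 1)) :
    ‖x (Fin.last m)‖ = 1 := by
  obtain ⟨z, hz, rfl⟩ := hx
  rw [symmMap_last, norm_prod]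
  exact Finset.prod_eq_one fun i _ => hz i

/-- A product of moduli at most one equals one only if every factor does. -/
theorem mem_bGam_of_mem_Gam {m : ℕ} {x : Fin (m + 1) → ℂ} (hx : x ∈ Gam (m + 1))
    (h : ‖x (Fin.last m)‖ = 1) : x ∈ bGam (m + 1) := by
  obtain ⟨z, hz, rfl⟩ := hx
  refine ⟨z, fun i => le_antisymm (hz i) ?_, rfl⟩
  rw [symmMap_last, norm_prod, ← Finset.mul_prod_erase _ _ (Finset.mem_univ i)] at h
  rw [← h]
  exact mul_le_of_le_one_right (norm_nonneg _)
    (Finset.prod_le_one (fun _ _ => norm_nonneg _) fun j _ => hz j)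

theorem bGam_subset_Gam (n : ℕ) : bGam n ⊆ Gam n :=
  Set.image_mono fun _ hz i => (hz i).le

theorem continuous_symmMap (n : ℕ) : Continuous (symmMap n) :=
  continuous_pi fun _ => MvPolynomial.continuous_eval _

theorem isCompact_Gam (n : ℕ) : IsCompact (Gam n) := by
  refine IsCompact.image ?_ (continuous_symmMap n)
  have := isCompact_univ_pi (X := fun _ : Fin n => ℂ) fun _ => isCompact_closedBall (0 : ℂ) 1
  convert this using 1
  ext z; simp [Set.mem_pi]

theorem isCompact_torus (n : ℕ) : IsCompact {z : Fin n → ℂ | ∀ i, ‖z i‖ = 1} := by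
  have := isCompact_univ_pi (X := fun _ : Fin n => ℂ) fun _ => isCompact_sphere (0 : ℂ) 1
  convert this using 1
  ext z; simp [Set.mem_pi]

theorem isCompact_bGam (n : ℕ) : IsCompact (bGam n) :=
  (isCompact_torus n).image (continuous_symmMap n)

/-! ### Derivatives: Gauss–Lucas and Cohn's criterion. -/

/-- The weighted tuple `((n-1)/n s_1, …, 1/n s_{n-1})`, for `n = m + 1`. -/
def derivTuple {m : ℕ} (x : Fin (m + 1) → ℂ) : Fin m → ℂ :=
  fun i => (((m : ℂ) - ((i : ℕ) : ℂ)) / ((m : ℂ) + 1)) * x i.castSucc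

open Polynomial in
theorem derivative_symmPoly (m : ℕ) (x : Fin (m + 1) → ℂ) :
    derivative (symmPoly (m + 1) x) = C ((m : ℂ) + 1) * symmPoly m (derivTuple x) := by
  have hm : (m : ℂ) + 1 ≠ 0 := by exact_mod_cast Nat.succ_ne_zero m
  rw [symmPoly, symmPoly, derivative_add, derivative_sum, Fin.sum_univ_castSucc, mul_add,
    Finset.mul_sum]
  congr 1
  · simp
  · rw [show ∀ p q : ℂ[X], q = 0 → p + q = p from fun p q h => by rw [h, add_zero]]
    · refine Finset.sum_congr rfl fun i _ => ?_
      have hi := i.2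
      rw [derivative_C_mul_X_pow, ← mul_assoc, ← C_mul]
      congr 2
      · simp only [derivTuple, Fin.val_castSucc]
        rw [show m + 1 - 1 - (i : ℕ) = m - i by omega, Nat.cast_sub hi.le]
        field_simp
      · simp only [Fin.val_castSucc]; omega
    · simp

open Polynomial in
theorem derivTuple_mem_Gam {m : ℕ} {x : Fin (m + 1) → ℂ} (hx : x ∈ Gam (m + 1)) :
    derivTuple x ∈ Gam m := by
  have hm : (m : ℂ) + 1 ≠ 0 := by exact_mod_cast Nat.succ_ne_zero m
  rw [Gam, mem_symmMap_image_iff m _ (fun w => ‖w‖ ≤ 1)]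
  rw [Gam, mem_symmMap_image_iff (m + 1) _ (fun w => ‖w‖ ≤ 1)] at hx
  intro w hw
  have hdeg : 0 < (symmPoly (m + 1) x).degree :=
    natDegree_pos_iff_degree_pos.1 (by rw [symmPoly_natDegree]; omega)
  have hd0 : derivative (symmPoly (m + 1) x) ≠ 0 := by
    rw [derivative_symmPoly]
    exact mul_ne_zero (C_ne_zero.2 hm) (symmPoly_monic _ _).ne_zero
  have hroot : w ∈ (derivative (symmPoly (m + 1) x)).rootSet ℂ := by
    rw [mem_rootSet]
    refine ⟨hd0, ?_⟩
    rw [coe_aeval_eq_eval, derivative_symmPoly, eval_mul, hw, mul_zero]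
  have h := rootSet_derivative_subset_convexHull_rootSet hdeg hroot
  have hsub : convexHull ℝ ((symmPoly (m + 1) x).rootSet ℂ) ⊆ Metric.closedBall (0 : ℂ) 1 := by
    refine convexHull_min (fun v hv => ?_) (convex_closedBall _ _)
    rw [mem_rootSet, coe_aeval_eq_eval] at hv
    simpa using hx v hv.2
  simpa using hsub h

open Polynomial in
-- With f the polynomial of x and N = m + 1, passing to N f - z f' multiplies the coefficient of
-- z^{N-k} by k. Self-inversiveness replaces x_k by conj(x_{N-k}) p, and k / N is the weight that
-- `derivTuple` puts on x_{N-k}. So the result is, up to the factor ±N p, the conjugate reversal of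
-- f' / N.
theorem self_inversive_identity {m : ℕ} {x : Fin (m + 1) → ℂ}
    (hx : ∀ i : Fin m, x i.castSucc = (starRingEnd ℂ) (x i.rev.castSucc) * x (Fin.last m))
    (z : ℂ) :
    ((m : ℂ) + 1) * (symmPoly (m + 1) x).eval z - z * (derivative (symmPoly (m + 1) x)).eval z =
      (-1) ^ (m + 1) * x (Fin.last m) * (((m : ℂ) + 1) *
        (1 + ∑ i : Fin m, (-1) ^ ((i : ℕ) + 1) * (starRingEnd ℂ) (derivTuple x i) *
          z ^ ((i : ℕ) + 1))) := by
  have hm : (m : ℂ) + 1 ≠ 0 := by exact_mod_cast Nat.succ_ne_zero m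
  rw [derivative_symmPoly, symmPoly, symmPoly]
  simp only [eval_add, eval_mul, eval_pow, eval_X, eval_C, eval_finsetSum]
  rw [Fin.sum_univ_castSucc]
  rw [← Equiv.sum_comp Fin.revPerm (fun i : Fin m => (-1) ^ ((i : ℕ) + 1) *
    (starRingEnd ℂ) (derivTuple x i) * z ^ ((i : ℕ) + 1))]
  simp only [mul_add, Finset.mul_sum, Fin.val_castSucc, Fin.val_last, Fin.revPerm_apply]
  have hterm : ∀ i : Fin m,
      ((m : ℂ) + 1) * ((-1) ^ ((i : ℕ) + 1) * x i.castSucc * z ^ (m + 1 - 1 - (i : ℕ))) -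
        z * (((m : ℂ) + 1) * ((-1) ^ ((i : ℕ) + 1) * derivTuple x i * z ^ (m - 1 - (i : ℕ)))) =
      (-1) ^ (m + 1) * x (Fin.last m) * (((m : ℂ) + 1) * ((-1) ^ ((i.rev : ℕ) + 1) *
        (starRingEnd ℂ) (derivTuple x i.rev) * z ^ ((i.rev : ℕ) + 1))) := by
    intro i
    obtain ⟨k, hk⟩ : ∃ k, m = i + 1 + k := ⟨m - (i + 1), by have := i.2; omega⟩
    have hr : (i.rev : ℕ) = k := by rw [Fin.val_rev]; omega
    have hc : (m : ℂ) = (i : ℕ) + 1 + k := by exact_mod_cast congrArg (Nat.cast (R := ℂ)) hk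
    rw [derivTuple, derivTuple, hx i, hr, show m + 1 - 1 - (i : ℕ) = k + 1 by omega,
      show m - 1 - (i : ℕ) = k by omega, map_mul, show (-1 : ℂ) ^ (m + 1) =
        (-1) ^ ((i : ℕ) + 1) * (-1) ^ (k + 1) by rw [← pow_add]; congr 1; omega]
    have h1 : ((-1 : ℂ) ^ (k + 1)) * (-1) ^ (k + 1) = 1 := by
      rw [← mul_pow]; norm_num
    have h2 : (starRingEnd ℂ) (((m : ℂ) - (k : ℂ)) / ((m : ℂ) + 1)) =
        ((m : ℂ) - (k : ℂ)) / ((m : ℂ) + 1) := by simp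
    rw [h2]
    generalize (starRingEnd ℂ) (x i.rev.castSucc) = y
    field_simp
    rw [mul_comm] at h1
    rw [pow_succ z k]
    generalize z ^ k = Z
    generalize (-1 : ℂ) ^ (k + 1) = f at *
    rw [hc]
    linear_combination (-(((i : ℕ) : ℂ) + 1) * y * Z * z * x (Fin.last m)) * h1
  have hsum := Finset.sum_congr (rfl : (Finset.univ : Finset (Fin m)) = _) fun i _ => hterm i
  rw [Finset.sum_sub_distrib] at hsum
  rw [← hsum]
  simp
  ring

open Polynomial in
-- Both sides are z^m conj(g(1 / conj z)), with g the monic polynomial with roots w_j; z = 0 is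
-- treated apart.
theorem reverse_symmPoly_eval {m : ℕ} (w : Fin m → ℂ) (z : ℂ) :
    1 + ∑ i : Fin m, (-1) ^ ((i : ℕ) + 1) * (starRingEnd ℂ) (symmMap m w i) * z ^ ((i : ℕ) + 1) =
      ∏ j, (1 - (starRingEnd ℂ) (w j) * z) := by
  by_cases hz : z = 0
  · subst hz; simp
  have h := congrArg (fun p => z ^ m * (starRingEnd ℂ) (p.eval ((starRingEnd ℂ) z⁻¹)))
    (symmPoly_symmMap m w)
  simp only [symmPoly, eval_add, eval_mul, eval_pow, eval_X, eval_C, eval_finsetSum, eval_prod,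
    eval_sub, map_add, map_mul, map_sum, map_prod, map_sub, map_pow, Complex.conj_conj, mul_add,
    Finset.mul_sum] at h
  have h1 : z ^ m * z⁻¹ ^ m = 1 := by rw [← mul_pow, mul_inv_cancel₀ hz, one_pow]
  have h2 : ∏ j, (1 - (starRingEnd ℂ) (w j) * z) =
      z ^ m * ∏ j, (z⁻¹ - (starRingEnd ℂ) (w j)) := by
    rw [← Fin.prod_const, ← Finset.prod_mul_distrib]
    refine Finset.prod_congr rfl fun j _ => ?_
    field_simp
  rw [h2, ← h, h1]
  congr 1
  refine Finset.sum_congr rfl fun i _ => ?_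
  have hi := i.2
  have h3 : z ^ m * z⁻¹ ^ (m - 1 - (i : ℕ)) = z ^ ((i : ℕ) + 1) := by
    have : z ^ m = z ^ ((i : ℕ) + 1) * z ^ (m - 1 - (i : ℕ)) := by
      rw [← pow_add]; congr 1; omega
    rw [this, mul_assoc, ← mul_pow, mul_inv_cancel₀ hz, one_pow, mul_one]
  rw [← h3]
  simp
  ring

theorem normSq_sub_sub_normSq (w z : ℂ) :
    Complex.normSq (z - w) - Complex.normSq (1 - (starRingEnd ℂ) w * z) =
      (Complex.normSq z - 1) * (1 - Complex.normSq w) := by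
  simp [Complex.normSq_apply]; ring

/-- Cohn's criterion: a self-inversive polynomial whose critical points lie in the closed unit disc
has all its roots on the unit circle. -/
theorem mem_bGam_of_derivTuple_mem_Gam {m : ℕ} {x : Fin (m + 1) → ℂ}
    (hx : ∀ i : Fin m, x i.castSucc = (starRingEnd ℂ) (x i.rev.castSucc) * x (Fin.last m))
    (hp : ‖x (Fin.last m)‖ = 1) (hd : derivTuple x ∈ Gam m) : x ∈ bGam (m + 1) := by
  have hm : (m : ℂ) + 1 ≠ 0 := by exact_mod_cast Nat.succ_ne_zero m
  rw [bGam, mem_symmMap_image_iff (m + 1) _ (fun w => ‖w‖ = 1)]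
  intro z hz
  obtain ⟨w, hw, hwd⟩ := hd
  have hw : ∀ j, ‖w j‖ ≤ 1 := hw
  have hid := self_inversive_identity hx z
  rw [hz, mul_zero, zero_sub, derivative_symmPoly, ← hwd, reverse_symmPoly_eval,
    symmPoly_symmMap, Polynomial.eval_mul, Polynomial.eval_C, Polynomial.eval_prod] at hid
  simp only [Polynomial.eval_sub, Polynomial.eval_X, Polynomial.eval_C] at hid
  -- The w_j are the critical points. Off the circle, `hcmp` compares the two products factor by
  -- factor, and the extra ‖z‖ makes equality impossible.
  have hn : ‖z‖ * ∏ j, ‖z - w j‖ = ∏ j, ‖1 - (starRingEnd ℂ) (w j) * z‖ := by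
    have := congrArg norm hid
    simp only [norm_neg, norm_mul, norm_pow, norm_one, one_pow, one_mul, hp, norm_prod] at this
    have h0 : ‖(m : ℂ) + 1‖ ≠ 0 := norm_ne_zero_iff.2 hm
    apply mul_left_cancel₀ h0
    linarith
  have hcmp : ∀ j, ‖z - w j‖ ^ 2 - ‖1 - (starRingEnd ℂ) (w j) * z‖ ^ 2 =
      (‖z‖ ^ 2 - 1) * (1 - ‖w j‖ ^ 2) := by
    intro j
    simpa only [Complex.normSq_eq_norm_sq] using normSq_sub_sub_normSq (w j) z
  have hw2 : ∀ j, 0 ≤ 1 - ‖w j‖ ^ 2 := fun j => by nlinarith [hw j, norm_nonneg (w j)]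
  rcases lt_trichotomy ‖z‖ 1 with h | h | h
  · exfalso
    have hle : ∏ j, ‖z - w j‖ ≤ ∏ j, ‖1 - (starRingEnd ℂ) (w j) * z‖ := by
      refine Finset.prod_le_prod (fun _ _ => norm_nonneg _) fun j _ => ?_
      refine le_of_sq_le_sq ?_ (norm_nonneg _)
      have : (‖z‖ ^ 2 - 1) * (1 - ‖w j‖ ^ 2) ≤ 0 :=
        mul_nonpos_of_nonpos_of_nonneg (by nlinarith [norm_nonneg z]) (hw2 j)
      linarith [hcmp j]
    have hpos : 0 < ∏ j, ‖1 - (starRingEnd ℂ) (w j) * z‖ := by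
      refine Finset.prod_pos fun j _ => norm_pos_iff.2 fun h0 => ?_
      have h1 : ‖(starRingEnd ℂ) (w j) * z‖ = 1 := by
        rw [← sub_eq_zero.1 h0, norm_one]
      rw [norm_mul, RCLike.norm_conj] at h1
      nlinarith [hw j, norm_nonneg (w j), norm_nonneg z]
    nlinarith [norm_nonneg z]
  · exact h
  · exfalso
    have hle : ∏ j, ‖1 - (starRingEnd ℂ) (w j) * z‖ ≤ ∏ j, ‖z - w j‖ := by
      refine Finset.prod_le_prod (fun _ _ => norm_nonneg _) fun j _ => ?_
      refine le_of_sq_le_sq ?_ (norm_nonneg _)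
      have : 0 ≤ (‖z‖ ^ 2 - 1) * (1 - ‖w j‖ ^ 2) := mul_nonneg (by nlinarith) (hw2 j)
      linarith [hcmp j]
    have hpos : 0 < ∏ j, ‖z - w j‖ := by
      refine Finset.prod_pos fun j _ => norm_pos_iff.2 fun h0 => ?_
      rw [sub_eq_zero.1 h0] at h
      exact absurd (hw j) (not_le.2 h)
    nlinarith

/-! ### The maximum principle and rational functions bounded by one on Γ_n. -/

theorem exists_update_norm_le {n : ℕ} (z : Fin n → ℂ) (j : Fin n) (hz : ‖z j‖ ≤ 1)
    (p q : MvPolynomial (Fin n) ℂ)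
    (hq : ∀ w : ℂ, ‖w‖ ≤ 1 → MvPolynomial.eval (Function.update z j w) q ≠ 0) :
    ∃ w : ℂ, ‖w‖ = 1 ∧ ‖MvPolynomial.eval z p / MvPolynomial.eval z q‖ ≤
      ‖MvPolynomial.eval (Function.update z j w) p /
        MvPolynomial.eval (Function.update z j w) q‖ := by
  have hpoly : ∀ r : MvPolynomial (Fin n) ℂ,
      Differentiable ℂ fun w : ℂ => MvPolynomial.eval (Function.update z j w) r := by
    intro r
    induction r using MvPolynomial.induction_on with
    | C a => simp
    | add p q hp hq => simp only [map_add]; exact hp.add hq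
    | mul_X p i hp =>
      simp only [map_mul, MvPolynomial.eval_X]
      refine hp.mul ?_
      by_cases h : i = j
      · subst h; simp
      · simp [Function.update_of_ne h]
  have hcl : closure (Metric.ball (0 : ℂ) 1) = Metric.closedBall 0 1 :=
    closure_ball 0 one_ne_zero
  have hd : DiffContOnCl ℂ (fun w : ℂ => MvPolynomial.eval (Function.update z j w) p /
      MvPolynomial.eval (Function.update z j w) q) (Metric.ball 0 1) := by
    refine DifferentiableOn.diffContOnCl ?_
    rw [hcl]
    exact (hpoly p).differentiableOn.div (hpoly q).differentiableOn
      fun w hw => hq w (by simpa using hw)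
  obtain ⟨w, hw, hmax⟩ := Complex.exists_mem_frontier_isMaxOn_norm Metric.isBounded_ball
    (Metric.nonempty_ball.2 one_pos) hd
  rw [frontier_ball 0 one_ne_zero] at hw
  rw [hcl] at hmax
  refine ⟨w, by simpa using hw, ?_⟩
  have := hmax (show z j ∈ Metric.closedBall (0 : ℂ) 1 by simpa using hz)
  simpa using this

/-- The maximum principle on the polydisc: a rational function is dominated by its values on the
torus. -/
theorem exists_torus_norm_le {n : ℕ} (p q : MvPolynomial (Fin n) ℂ)
    (hq : ∀ z : Fin n → ℂ, (∀ i, ‖z i‖ ≤ 1) → MvPolynomial.eval z q ≠ 0)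
    (z : Fin n → ℂ) (hz : ∀ i, ‖z i‖ ≤ 1) :
    ∃ w : Fin n → ℂ, (∀ i, ‖w i‖ = 1) ∧ ‖MvPolynomial.eval z p / MvPolynomial.eval z q‖ ≤
      ‖MvPolynomial.eval w p / MvPolynomial.eval w q‖ := by
  suffices h : ∀ s : Finset (Fin n), ∃ w : Fin n → ℂ, (∀ i, ‖w i‖ ≤ 1) ∧ (∀ i ∈ s, ‖w i‖ = 1) ∧
      ‖MvPolynomial.eval z p / MvPolynomial.eval z q‖ ≤
        ‖MvPolynomial.eval w p / MvPolynomial.eval w q‖ by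
    obtain ⟨w, -, h1, h2⟩ := h Finset.univ
    exact ⟨w, fun i => h1 i (Finset.mem_univ i), h2⟩
  intro s
  induction s using Finset.induction_on with
  | empty => exact ⟨z, hz, by simp, le_rfl⟩
  | insert j s hj ih =>
    obtain ⟨w, h1, h2, h3⟩ := ih
    have hup : ∀ v : ℂ, ‖v‖ ≤ 1 → ∀ i, ‖Function.update w j v i‖ ≤ 1 := by
      intro v hv i
      by_cases h : i = j
      · subst h; simpa using hv
      · simpa [Function.update_of_ne h] using h1 i
    obtain ⟨v, hv, hle⟩ := exists_update_norm_le w j (h1 j) p q fun v hv => hq _ (hup v hv)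
    refine ⟨Function.update w j v, hup v hv.le, ?_, h3.trans hle⟩
    intro i hi
    by_cases h : i = j
    · subst h; simpa using hv
    · rw [Function.update_of_ne h]
      exact h2 i ((Finset.mem_insert.1 hi).resolve_left h)

/-- A Möbius-type rational function of modulus at most one on the symmetrized polydisc. -/
theorem norm_div_le_one_of_mem_Gam {m : ℕ} (i : Fin m) (c : ℝ) (α : ℂ) (hα : ‖α‖ = 1)
    (hc : ∀ x ∈ Gam (m + 1), ‖x i.castSucc‖ < c) {x : Fin (m + 1) → ℂ} (hx : x ∈ Gam (m + 1)) :
    c - α * x i.castSucc ≠ 0 ∧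
      ‖(c * α * x (Fin.last m) - x i.rev.castSucc) / (c - α * x i.castSucc)‖ ≤ 1 := by
  have hne : ∀ x ∈ Gam (m + 1), (c : ℂ) - α * x i.castSucc ≠ 0 := by
    intro x hx h0
    have h1 := congrArg norm (sub_eq_zero.1 h0)
    rw [norm_mul, hα, one_mul, Complex.norm_real] at h1
    exact absurd (le_abs_self c) (not_le.2 (by rw [← Real.norm_eq_abs, h1]; exact hc x hx))
  refine ⟨hne x hx, ?_⟩
  obtain ⟨z, hz, rfl⟩ := hx
  set p : MvPolynomial (Fin (m + 1)) ℂ :=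
    MvPolynomial.C (c * α) * MvPolynomial.esymm _ ℂ (((Fin.last m : Fin (m + 1)) : ℕ) + 1) -
      MvPolynomial.esymm _ ℂ ((i.rev.castSucc : ℕ) + 1) with hp
  set q : MvPolynomial (Fin (m + 1)) ℂ :=
    MvPolynomial.C (c : ℂ) - MvPolynomial.C α * MvPolynomial.esymm _ ℂ ((i.castSucc : ℕ) + 1) with hq
  have hpe : ∀ w, MvPolynomial.eval w p = c * α * symmMap (m + 1) w (Fin.last m) -
      symmMap (m + 1) w i.rev.castSucc := by
    intro w; rw [hp]; simp only [map_sub, map_mul, MvPolynomial.eval_C]; rfl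
  have hqe : ∀ w, MvPolynomial.eval w q = c - α * symmMap (m + 1) w i.castSucc := by
    intro w; rw [hq]; simp only [map_sub, map_mul, MvPolynomial.eval_C]; rfl
  obtain ⟨w, hw, hle⟩ := exists_torus_norm_le p q
    (fun z hz => by rw [hqe]; exact hne _ ⟨z, hz, rfl⟩) z hz
  rw [hpe, hqe, hpe, hqe] at hle
  refine hle.trans (le_of_eq ?_)
  have hb : symmMap (m + 1) w ∈ bGam (m + 1) := ⟨w, hw, rfl⟩
  have h1 := bGam_castSucc hb i.rev
  rw [Fin.rev_rev] at h1
  rw [norm_div, div_eq_one_iff_eq (norm_ne_zero_iff.2 (hne _ (bGam_subset_Gam _ hb))), h1,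
    ← sub_mul, norm_mul, norm_last_bGam hb, mul_one, ← RCLike.norm_conj]
  -- On the torus the numerator is p (cα - conj s_i), and the denominator is α times the conjugate
  -- of that bracket: the quotient is unimodular.
  have h2 : (c : ℂ) - α * symmMap (m + 1) w i.castSucc =
      α * ((starRingEnd ℂ) (c * α - (starRingEnd ℂ) (symmMap (m + 1) w i.castSucc))) := by
    have := conj_mul_self_of_norm_eq_one hα
    simp only [map_sub, map_mul, Complex.conj_ofReal, Complex.conj_conj]
    linear_combination (-(c : ℂ)) * this
  rw [h2, norm_mul, hα, one_mul]

/-! ### Gelfand duality: elements of `A` as continuous functions of characters. -/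

open WeakDual

section Gelfand

variable {A : Type*} [CommCStarAlgebra A]

theorem exists_forall_character_eq (f : C(characterSpace ℂ A, ℂ)) :
    ∃ a : A, ∀ x : characterSpace ℂ A, x a = f x :=
  ⟨(gelfandStarTransform A).symm f, fun x =>
    congrArg (fun g : C(characterSpace ℂ A, ℂ) => g x) ((gelfandStarTransform A).apply_symm_apply f)⟩

theorem ext_character {a b : A} (h : ∀ x : characterSpace ℂ A, x a = x b) : a = b :=
  (gelfandTransform_isometry A).injective (ContinuousMap.ext h)

theorem norm_le_of_forall_character {a : A} {C : ℝ} (hC : 0 ≤ C)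
    (h : ∀ x : characterSpace ℂ A, ‖x a‖ ≤ C) : ‖a‖ ≤ C := by
  rw [← (AddMonoidHomClass.isometry_iff_norm (gelfandTransform ℂ A)).1
    (gelfandTransform_isometry A) a]
  exact (ContinuousMap.norm_le _ hC).2 h

theorem norm_character_le (a : A) (x : characterSpace ℂ A) : ‖x a‖ ≤ ‖a‖ := by
  rw [← (AddMonoidHomClass.isometry_iff_norm (gelfandTransform ℂ A)).1
    (gelfandTransform_isometry A) a]
  exact ContinuousMap.norm_coe_le_norm (gelfandTransform ℂ A a) x

theorem continuous_character_apply (a : A) : Continuous fun x : characterSpace ℂ A => x a :=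
  (gelfandTransform ℂ A a).continuous

theorem isUnit_of_forall_character_ne_zero {a : A} (h : ∀ x : characterSpace ℂ A, x a ≠ 0) :
    IsUnit a := by
  by_contra ha
  obtain ⟨x, hx⟩ := WeakDual.CharacterSpace.exists_apply_eq_zero ha
  exact h x hx

theorem exists_bump {U : Set (characterSpace ℂ A)} (hU : IsOpen U) {x : characterSpace ℂ A}
    (hx : x ∈ U) : ∃ a : A, x a = 1 ∧ (∀ y ∉ U, y a = 0) ∧ ∀ y : characterSpace ℂ A, ‖y a‖ ≤ 1 := by
  obtain ⟨f, hf0, hf1, hf⟩ := exists_continuous_zero_one_of_isClosed hU.isClosed_compl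
    (isClosed_singleton (x := x)) (Set.disjoint_singleton_right.2 fun h => h hx)
  obtain ⟨a, ha⟩ := exists_forall_character_eq
    ((⟨fun r : ℝ => (r : ℂ), Complex.continuous_ofReal⟩ : C(ℝ, ℂ)).comp f)
  have ha : ∀ y : characterSpace ℂ A, y a = (f y : ℂ) := ha
  refine ⟨a, ?_, fun y hy => ?_, fun y => ?_⟩
  · rw [ha, hf1 rfl]; simp
  · rw [ha, hf0 hy]; simp
  · rw [ha, Complex.norm_real, Real.norm_eq_abs, abs_le]
    exact ⟨by linarith [(hf y).1], (hf y).2⟩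

end Gelfand

/-! ### Bicommutants and their character spaces. -/

section Rep

universe u

variable {H : Type u} [NormedAddCommGroup H] [InnerProductSpace ℂ H] [CompleteSpace H]

/-- The bicommutant of the star-closure of `W`. -/
def bicommutant (W : Set (H →L[ℂ] H)) : StarSubalgebra ℂ (H →L[ℂ] H) :=
  StarSubalgebra.centralizer ℂ (StarSubalgebra.centralizer ℂ W : Set (H →L[ℂ] H))

theorem mem_bicommutant_iff (W : Set (H →L[ℂ] H)) (a : H →L[ℂ] H) :
    a ∈ bicommutant W ↔ ∀ g ∈ StarSubalgebra.centralizer ℂ W, g * a = a * g := by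
  rw [bicommutant, StarSubalgebra.mem_centralizer_iff]
  exact ⟨fun h g hg => (h g hg).1, fun h g hg => ⟨h g hg, h _ (star_mem hg)⟩⟩

theorem subset_bicommutant (W : Set (H →L[ℂ] H)) : W ⊆ bicommutant W := by
  intro a ha
  rw [SetLike.mem_coe, mem_bicommutant_iff]
  intro g hg
  exact (((StarSubalgebra.mem_centralizer_iff ℂ).1 hg) a ha).1.symm

theorem isClosed_bicommutant (W : Set (H →L[ℂ] H)) :
    IsClosed (bicommutant W : Set (H →L[ℂ] H)) := by
  have : (bicommutant W : Set (H →L[ℂ] H)) =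
      ⋂ g ∈ StarSubalgebra.centralizer ℂ W, {a | g * a = a * g} := by
    ext a; simp [mem_bicommutant_iff]
  rw [this]
  exact isClosed_biInter fun g _ =>
    isClosed_eq (continuous_const.mul continuous_id) (continuous_id.mul continuous_const)

/-- The hypothesis puts W inside its own star-commutant W', whence W'' ⊆ W'; elements of W'' commute
with W'. -/
theorem bicommutant_comm {W : Set (H →L[ℂ] H)}
    (hW : ∀ a ∈ W, ∀ b ∈ W, Commute a b ∧ Commute a (star b)) {a b : H →L[ℂ] H}
    (ha : a ∈ bicommutant W) (hb : b ∈ bicommutant W) : a * b = b * a := by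
  have hle : ∀ w ∈ W, w ∈ StarSubalgebra.centralizer ℂ W := by
    intro w hw
    rw [StarSubalgebra.mem_centralizer_iff]
    intro g hg
    exact ⟨(hW g hg w hw).1.eq, ((hW w hw g hg).2.eq).symm⟩
  have ha' : a ∈ StarSubalgebra.centralizer ℂ W := by
    rw [StarSubalgebra.mem_centralizer_iff]
    intro g hg
    rw [mem_bicommutant_iff] at ha
    exact ⟨ha g (hle g hg), ha _ (star_mem (hle g hg))⟩
  exact ((mem_bicommutant_iff W b).1 hb) a ha'

/-- The bicommutant of a family of commuting normal operators, as a commutative C⋆-algebra. -/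
theorem exists_commCStarAlgebra {W : Set (H →L[ℂ] H)}
    (hW : ∀ a ∈ W, ∀ b ∈ W, Commute a b ∧ Commute a (star b)) :
    ∃ (A : Type u) (_ : CommCStarAlgebra A) (φ : A →⋆ₐ[ℂ] (H →L[ℂ] H)),
      Isometry φ ∧ ∀ T, T ∈ bicommutant W ↔ ∃ a, φ a = T := by
  have := isClosed_bicommutant W
  let : CommCStarAlgebra (bicommutant W) :=
    { StarSubalgebra.cstarAlgebra (bicommutant W) with
      mul_comm := fun a b => Subtype.ext (bicommutant_comm hW a.2 b.2) }
  exact ⟨bicommutant W, inferInstance, (bicommutant W).subtype, isometry_subtype_coe,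
    fun T => ⟨fun h => ⟨⟨T, h⟩, rfl⟩, fun ⟨a, h⟩ => h ▸ a.2⟩⟩

theorem commute_starProjection (K : Submodule ℂ H) [K.HasOrthogonalProjection] (T : H →L[ℂ] H)
    (h1 : ∀ v ∈ K, T v ∈ K) (h2 : ∀ v ∈ K, (star T) v ∈ K) :
    T * K.starProjection = K.starProjection * T := by
  ext v
  change T (K.starProjection v) = K.starProjection (T v)
  refine (Submodule.eq_starProjection_of_mem_orthogonal
    (h1 _ (Submodule.starProjection_apply_mem K v)) ?_).symm
  rw [← map_sub, Submodule.mem_orthogonal]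
  intro k hk
  rw [← ContinuousLinearMap.adjoint_inner_left]
  exact (Submodule.mem_orthogonal K _).1 (Submodule.sub_starProjection_mem_orthogonal v) _ (h2 k hk)

/-- For open U, project onto the closed span of the ranges of all elements supported in U. This
subspace reduces the commutant, so the projection lies in the bicommutant; its Gelfand transform is
1 on U and 0 off the closure of U, which is therefore open. -/
theorem extremallyDisconnected_characterSpace {W : Set (H →L[ℂ] H)} {A : Type u}
    [CommCStarAlgebra A] (φ : A →⋆ₐ[ℂ] (H →L[ℂ] H)) (hφ : Isometry φ)
    (hr : ∀ T, T ∈ bicommutant W ↔ ∃ a, φ a = T) :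
    ExtremallyDisconnected (characterSpace ℂ A) := by
  refine ⟨fun U hU => ?_⟩
  set s : Set H := {v | ∃ a : A, (∀ y ∉ U, y a = 0) ∧ ∃ h, v = φ a h} with hs
  set K : Submodule ℂ H := (Submodule.span ℂ s).topologicalClosure with hK
  have hKext : ∀ T S : H →L[ℂ] H, (∀ v ∈ s, T v = S v) → ∀ v ∈ K, T v = S v := by
    intro T S hTS v hv
    have hcl : IsClosed {v | T v = S v} := isClosed_eq T.continuous S.continuous
    refine closure_minimal ?_ hcl hv
    exact Submodule.span_le (p := LinearMap.eqLocus (T : H →ₗ[ℂ] H) (S : H →ₗ[ℂ] H)).2 hTS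
  have hinv : ∀ T ∈ StarSubalgebra.centralizer ℂ W, ∀ v ∈ K, T v ∈ K := by
    intro T hT v hv
    have hcl : IsClosed (T ⁻¹' (K : Set H)) :=
      (Submodule.isClosed_topologicalClosure _).preimage T.continuous
    refine closure_minimal ?_ hcl hv
    refine Submodule.span_le (p := K.comap (T : H →ₗ[ℂ] H)).2 ?_
    rintro _ ⟨a, ha, h, rfl⟩
    refine Submodule.le_topologicalClosure _ (Submodule.subset_span ⟨a, ha, T h, ?_⟩)
    have := (mem_bicommutant_iff W (φ a)).1 ((hr _).2 ⟨a, rfl⟩) T hT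
    exact congrArg (fun S : H →L[ℂ] H => S h) this
  have hcompl : CompleteSpace K := (Submodule.isClosed_topologicalClosure _).completeSpace_coe
  obtain ⟨e, he⟩ : ∃ e, φ e = K.starProjection := by
    rw [← hr, mem_bicommutant_iff]
    intro T hT
    exact commute_starProjection K T (hinv T hT) (hinv _ (star_mem hT))
  have h1 : ∀ a : A, (∀ y ∉ U, y a = 0) → e * a = a := by
    intro a ha
    apply hφ.injective
    rw [map_mul, he]
    ext h
    exact Submodule.starProjection_eq_self_iff.2
      (Submodule.le_topologicalClosure _ (Submodule.subset_span ⟨a, ha, h, rfl⟩))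
  have h2 : ∀ b : A, (∀ y ∈ U, y b = 0) → b * e = 0 := by
    intro b hb
    apply hφ.injective
    rw [map_mul, he, map_zero]
    ext h
    refine hKext (φ b) 0 ?_ _ (Submodule.starProjection_apply_mem K h)
    rintro _ ⟨a, ha, h, rfl⟩
    have h0 : b * a = 0 := by
      refine ext_character fun x => ?_
      rw [map_mul, map_zero]
      by_cases hx : x ∈ U
      · rw [hb x hx, zero_mul]
      · rw [ha x hx, mul_zero]
    have := congrArg (fun S : H →L[ℂ] H => S h) (congrArg φ h0)
    simpa using this
  have hcl : closure U = {x : characterSpace ℂ A | x e ≠ 0} := by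
    apply Set.Subset.antisymm
    · have : closure U ⊆ {x : characterSpace ℂ A | x e = 1} := by
        refine closure_minimal (fun x hx => ?_)
          (isClosed_eq (continuous_character_apply e) continuous_const)
        obtain ⟨a, ha1, ha0, -⟩ := exists_bump hU hx
        have := congrArg x (h1 a ha0)
        rwa [map_mul, ha1, mul_one] at this
      intro x hx
      have h : x e = 1 := this hx
      simp [h]
    · intro x hx
      by_contra hxU
      obtain ⟨b, hb1, hb0, -⟩ := exists_bump isClosed_closure.isOpen_compl hxU
      have := congrArg x (h2 b fun y hy => hb0 y fun h => h (subset_closure hy))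
      rw [map_mul, hb1, one_mul, map_zero] at this
      exact hx this
  rw [hcl]
  exact isOpen_ne_fun (continuous_character_apply e) continuous_const

end Rep

/-! ### The Koszul complex and the Taylor spectrum. -/

section Koszul

variable {H : Type*} [NormedAddCommGroup H] [InnerProductSpace ℂ H]

theorem koszulMap_tmul {n : ℕ} (T : Fin n → H →L[ℂ] H) (h : H)
    (w : ExteriorAlgebra ℂ (Fin n → ℂ)) :
    koszulMap T (h ⊗ₜ w) = ∑ i, T i h ⊗ₜ (ExteriorAlgebra.ι ℂ (Pi.single i (1 : ℂ)) * w) := by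
  simp [koszulMap, LinearMap.sum_apply]

/-- The T_i commute and the creation operators anticommute, so the double sum equals its own
negative. -/
theorem koszulMap_comp_self {n : ℕ} {T : Fin n → H →L[ℂ] H} (hT : IsCommuting T)
    (ξ : H ⊗[ℂ] ExteriorAlgebra ℂ (Fin n → ℂ)) : koszulMap T (koszulMap T ξ) = 0 := by
  induction ξ using TensorProduct.induction_on with
  | zero => simp
  | add x y hx hy => rw [map_add, map_add, hx, hy, add_zero]
  | tmul h w =>
    rw [koszulMap_tmul, map_sum]
    simp only [koszulMap_tmul]
    set S := ∑ x, ∑ i, (T i (T x h)) ⊗ₜ[ℂ] (ExteriorAlgebra.ι ℂ (Pi.single i (1 : ℂ) : Fin n → ℂ) *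
      (ExteriorAlgebra.ι ℂ (Pi.single x (1 : ℂ) : Fin n → ℂ) * w)) with hS
    have h2 : S + S = 0 := by
      nth_rewrite 2 [hS]
      rw [Finset.sum_comm, hS, ← Finset.sum_add_distrib]
      refine Finset.sum_eq_zero fun i _ => ?_
      rw [← Finset.sum_add_distrib]
      refine Finset.sum_eq_zero fun j _ => ?_
      have hc : T i (T j h) = T j (T i h) := congrArg (fun R : H →L[ℂ] H => R h) (hT i j).eq
      rw [hc, ← TensorProduct.tmul_add, ← mul_assoc, ← mul_assoc, ← add_mul,
        ExteriorAlgebra.ι_add_mul_swap, zero_mul, TensorProduct.tmul_zero]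
    rw [← two_smul ℂ] at h2
    exact (smul_eq_zero.1 h2).resolve_left two_ne_zero

/-- A commuting tuple with a commuting left inverse row is non-singular: contraction against the
row is a homotopy. -/
theorem isNonsingular_of_sum_mul_eq_one {n : ℕ} {T B : Fin n → H →L[ℂ] H} (hT : IsCommuting T)
    (hB : ∀ i j, Commute (B i) (T j)) (h1 : ∑ i, B i * T i = 1) : IsNonsingular T := by
  apply le_antisymm
  · rintro _ ⟨ξ, rfl⟩
    exact koszulMap_comp_self hT ξ
  · intro ξ hξ
    set C : (H ⊗[ℂ] ExteriorAlgebra ℂ (Fin n → ℂ)) →ₗ[ℂ] (H ⊗[ℂ] ExteriorAlgebra ℂ (Fin n → ℂ)) :=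
      ∑ j, TensorProduct.map (B j : H →ₗ[ℂ] H)
        (CliffordAlgebra.contractLeft (Q := (0 : QuadraticForm ℂ (Fin n → ℂ)))
          (LinearMap.proj j : (Fin n → ℂ) →ₗ[ℂ] ℂ)) with hC
    have hCt : ∀ h w, C (h ⊗ₜ w) = ∑ j, B j h ⊗ₜ
        (CliffordAlgebra.contractLeft (Q := (0 : QuadraticForm ℂ (Fin n → ℂ)))
          (LinearMap.proj j : (Fin n → ℂ) →ₗ[ℂ] ℂ) w) := by
      intro h w; simp [hC, LinearMap.sum_apply]
    have key : ∀ η, koszulMap T (C η) + C (koszulMap T η) = η := by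
      intro η
      induction η using TensorProduct.induction_on with
      | zero => simp
      | add x y hx hy =>
        rw [map_add, map_add, map_add, map_add, add_add_add_comm, hx, hy]
      | tmul h w =>
        rw [koszulMap_tmul, hCt, map_sum, map_sum]
        simp only [koszulMap_tmul, hCt]
        rw [Finset.sum_comm, ← Finset.sum_add_distrib]
        have : ∀ i, (∑ j, (T i (B j h)) ⊗ₜ[ℂ] (ExteriorAlgebra.ι ℂ (Pi.single i (1 : ℂ) : Fin n → ℂ) *
              (CliffordAlgebra.contractLeft (Q := (0 : QuadraticForm ℂ (Fin n → ℂ)))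
                (LinearMap.proj j : (Fin n → ℂ) →ₗ[ℂ] ℂ) w))) +
            (∑ j, (B j (T i h)) ⊗ₜ[ℂ]
              (CliffordAlgebra.contractLeft (Q := (0 : QuadraticForm ℂ (Fin n → ℂ)))
                (LinearMap.proj j : (Fin n → ℂ) →ₗ[ℂ] ℂ)
                (ExteriorAlgebra.ι ℂ (Pi.single i (1 : ℂ) : Fin n → ℂ) * w))) =
            (B i (T i h)) ⊗ₜ[ℂ] w := by
          intro i
          -- Contraction by the j-th coordinate and multiplication by e_i anticommute up to δ_ij, so
          -- only j = i survives.
          rw [← Finset.sum_add_distrib, Finset.sum_eq_single i]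
          · have hc : T i (B i h) = B i (T i h) :=
              congrArg (fun R : H →L[ℂ] H => R h) (hB i i).eq.symm
            rw [hc, ← TensorProduct.tmul_add]
            congr 1
            erw [CliffordAlgebra.contractLeft_ι_mul]
            simp
          · intro j _ hj
            have hc : T i (B j h) = B j (T i h) :=
              congrArg (fun R : H →L[ℂ] H => R h) (hB j i).eq.symm
            rw [hc, ← TensorProduct.tmul_add]
            erw [CliffordAlgebra.contractLeft_ι_mul]
            simp [hj]
          · simp
        rw [Finset.sum_congr rfl fun i _ => this i, ← TensorProduct.sum_tmul]
        congr 1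
        have := congrArg (fun R : H →L[ℂ] H => R h) h1
        simpa [sum_apply] using this
    have h0 : koszulMap T ξ = 0 := hξ
    have := key ξ
    rw [h0, map_zero, add_zero] at this
    exact ⟨C ξ, this⟩

/-- Exactness of the Koszul complex at the top degree. -/
theorem IsNonsingular.exists_sum_eq {n : ℕ} {T : Fin n → H →L[ℂ] H} (hT : IsNonsingular T)
    (h : H) : ∃ g : Fin n → H, ∑ i, T i (g i) = h := by
  classical
  set ω : ExteriorAlgebra ℂ (Fin n → ℂ) :=
    ExteriorAlgebra.ιMulti ℂ n fun i => (Pi.single i (1 : ℂ) : Fin n → ℂ) with hω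
  -- The determinant in degree n, extended by zero, reads off the coefficient of e_1 ∧ ⋯ ∧ e_n.
  set top : ExteriorAlgebra ℂ (Fin n → ℂ) →ₗ[ℂ] ℂ :=
    ExteriorAlgebra.liftAlternating
      (Pi.single (M := fun k => (Fin n → ℂ) [⋀^Fin k]→ₗ[ℂ] ℂ) n Matrix.detRowAlternating) with htop
  have h1 : top ω = 1 := by
    rw [htop, hω, ExteriorAlgebra.liftAlternating_apply_ιMulti, Pi.single_eq_same]
    change Matrix.det (fun i => (Pi.single i (1 : ℂ) : Fin n → ℂ)) = 1
    rw [← Matrix.det_one (n := Fin n) (R := ℂ)]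
    congr 1
    ext i j
    simp [Matrix.one_apply, Pi.single_apply, eq_comm]
  have h2 : ∀ i, ExteriorAlgebra.ι ℂ (Pi.single i (1 : ℂ) : Fin n → ℂ) * ω = 0 := by
    intro i
    have : ExteriorAlgebra.ι ℂ (Pi.single i (1 : ℂ) : Fin n → ℂ) * ω =
        ExteriorAlgebra.ιMulti ℂ (n + 1) (Fin.cons (Pi.single i (1 : ℂ) : Fin n → ℂ)
          fun i => (Pi.single i (1 : ℂ) : Fin n → ℂ)) := by
      rw [ExteriorAlgebra.ιMulti_succ_apply]; rfl
    rw [this]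
    exact AlternatingMap.map_eq_zero_of_eq _ _ (i := 0) (j := i.succ) (by simp)
      (Fin.succ_ne_zero i).symm
  have hker : h ⊗ₜ[ℂ] ω ∈ LinearMap.ker (koszulMap T) := by
    rw [LinearMap.mem_ker, koszulMap_tmul]
    exact Finset.sum_eq_zero fun i _ => by rw [h2, TensorProduct.tmul_zero]
  rw [← hT] at hker
  obtain ⟨ξ, hξ⟩ := hker
  set F : (ExteriorAlgebra ℂ (Fin n → ℂ) →ₗ[ℂ] ℂ) → (H ⊗[ℂ] ExteriorAlgebra ℂ (Fin n → ℂ)) →ₗ[ℂ] H :=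
    fun f => (TensorProduct.rid ℂ H).toLinearMap ∘ₗ TensorProduct.map LinearMap.id f with hF
  have hFt : ∀ f h w, F f (h ⊗ₜ w) = f w • h := by
    intro f h w; simp [hF]
  refine ⟨fun i => F (top ∘ₗ LinearMap.mulLeft ℂ
    (ExteriorAlgebra.ι ℂ (Pi.single i (1 : ℂ) : Fin n → ℂ))) ξ, ?_⟩
  have key : ∀ η, F top (koszulMap T η) = ∑ i, T i (F (top ∘ₗ LinearMap.mulLeft ℂ
      (ExteriorAlgebra.ι ℂ (Pi.single i (1 : ℂ) : Fin n → ℂ))) η) := by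
    intro η
    induction η using TensorProduct.induction_on with
    | zero => simp
    | add x y hx hy => simp only [map_add, hx, hy, Finset.sum_add_distrib]
    | tmul h w =>
      rw [koszulMap_tmul, map_sum]
      refine Finset.sum_congr rfl fun i _ => ?_
      rw [hFt, hFt, map_smul]; rfl
  rw [← key, hξ, hFt, h1, one_smul]

theorem opEval_map {B : Type*} [CommRing B] [Algebra ℂ B] {n : ℕ} (φ : B →ₐ[ℂ] (H →L[ℂ] H))
    (b : Fin n → B) (p : MvPolynomial (Fin n) ℂ) :
    opEval (fun i => φ (b i)) p = φ (MvPolynomial.aeval b p) := by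
  rw [opEval, MvPolynomial.aeval_def, MvPolynomial.eval₂_eq', map_sum]
  refine Finset.sum_congr rfl fun m _ => ?_
  rw [← Algebra.smul_def, map_smul, ← List.prod_ofFn, map_list_prod, List.map_ofFn]
  simp [Function.comp_def]

theorem character_aeval {A : Type*} [CommCStarAlgebra A] {n : ℕ} (a : Fin n → A)
    (p : MvPolynomial (Fin n) ℂ) (x : characterSpace ℂ A) :
    x (MvPolynomial.aeval a p) = MvPolynomial.eval (fun i => x (a i)) p := by
  induction p using MvPolynomial.induction_on with
  | C c => simp [AlgHomClass.commutes x c]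
  | add p q hp hq => simp [hp, hq]
  | mul_X p i hp => simp [hp]

variable [CompleteSpace H]

/-- Over a commutative C⋆-algebra the Taylor spectrum consists of the values of characters. -/
theorem taylorSpectrum_eq_range {A : Type*} [CommCStarAlgebra A] (φ : A →⋆ₐ[ℂ] (H →L[ℂ] H))
    (hφ : Isometry φ) {n : ℕ} (a : Fin n → A) :
    taylorSpectrum (fun i => φ (a i)) =
      Set.range fun (x : characterSpace ℂ A) (i : Fin n) => x (a i) := by
  have hmap : ∀ l : Fin n → ℂ, (fun i => φ (a i) - l i • (1 : H →L[ℂ] H)) =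
      fun i => φ (a i - l i • (1 : A)) := by
    intro l; funext i; rw [map_sub, map_smul, map_one]
  have hchar : ∀ (x : characterSpace ℂ A) (l : Fin n → ℂ) (i : Fin n),
      x (a i - l i • (1 : A)) = x (a i) - l i := by
    intro x l i; rw [map_sub, map_smul, map_one, smul_eq_mul, mul_one]
  apply Set.Subset.antisymm
  · intro l hl
    by_contra hnot
    refine hl ?_
    rw [hmap]
    set b : Fin n → A := fun i => a i - l i • (1 : A) with hb
    -- Its value at a character is ∑ |x(b_i)|², zero only if l is the joint value there. Its inverse
    -- times `star (b i)` gives the left inverse row.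
    have hu : IsUnit (∑ i, star (b i) * b i) := by
      refine isUnit_of_forall_character_ne_zero fun x hx => hnot ⟨x, ?_⟩
      rw [map_sum] at hx
      have h1 : ∀ i, x (star (b i) * b i) = ((‖x (b i)‖ ^ 2 : ℝ) : ℂ) := by
        intro i
        rw [map_mul, map_star, mul_comm, Complex.star_def, Complex.mul_conj,
          Complex.normSq_eq_norm_sq]
      rw [Finset.sum_congr rfl fun i _ => h1 i, ← Complex.ofReal_sum, Complex.ofReal_eq_zero,
        Finset.sum_eq_zero_iff_of_nonneg fun _ _ => sq_nonneg _] at hx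
      funext i
      have h2 := hx i (Finset.mem_univ i)
      rw [sq_eq_zero_iff, norm_eq_zero, hb, hchar, sub_eq_zero] at h2
      exact h2
    obtain ⟨c, hc⟩ := hu.exists_left_inv
    refine isNonsingular_of_sum_mul_eq_one (B := fun i => φ (c * star (b i)))
      (fun i j => (Commute.all (b i) (b j)).map φ)
      (fun i j => (Commute.all (c * star (b i)) (b j)).map φ) ?_
    change ∑ i, φ (c * star (b i)) * φ (b i) = 1
    simp only [← map_mul, ← map_sum, mul_assoc, ← Finset.mul_sum]
    rw [hc, map_one]
  · rintro _ ⟨x, rfl⟩ hns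
    rw [hmap] at hns
    set b : Fin n → A := fun i => a i - x (a i) • (1 : A) with hb
    have hb0 : ∀ i, x (b i) = 0 := fun i => by
      rw [hb]
      change x (a i - x (a i) • (1 : A)) = 0
      rw [map_sub, map_smul, map_one, smul_eq_mul, mul_one, sub_self]
    set R : (Fin n → H) →L[ℂ] H := ∑ i, (φ (b i)) ∘L (ContinuousLinearMap.proj i) with hR
    have hRa : ∀ g, R g = ∑ i, φ (b i) (g i) := by
      intro g; simp [hR]
    have hsurj : Function.Surjective R := by
      intro h
      obtain ⟨g, hg⟩ := hns.exists_sum_eq h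
      exact ⟨g, by rw [hRa]; exact hg⟩
    obtain ⟨C, hC, hpre⟩ := R.exists_preimage_norm_le hsurj
    -- Dual form of surjectivity: pair h with a preimage under the row R whose norm the open mapping
    -- theorem controls.
    have hbelow : ∀ h : H, ‖h‖ ≤ C * ∑ i, ‖φ (star (b i)) h‖ := by
      intro h
      obtain ⟨g, hg, hgn⟩ := hpre h
      rcases eq_or_ne h 0 with rfl | hne
      · rw [norm_zero]; positivity
      have hpos : 0 < ‖h‖ := norm_pos_iff.2 hne
      have h1 : ‖h‖ * ‖h‖ ≤ ‖h‖ * (C * ∑ i, ‖φ (star (b i)) h‖) := by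
        calc ‖h‖ * ‖h‖ = ‖inner ℂ h h‖ := by
              rw [inner_self_eq_norm_sq_to_K]; simp [sq]
          _ = ‖∑ i, inner ℂ (g i) (φ (star (b i)) h)‖ := by
              nth_rewrite 1 [← hg]
              rw [hRa, sum_inner]
              congr 1
              refine Finset.sum_congr rfl fun i _ => ?_
              rw [map_star, ContinuousLinearMap.star_eq_adjoint,
                ContinuousLinearMap.adjoint_inner_right]
          _ ≤ ∑ i, ‖g i‖ * ‖φ (star (b i)) h‖ :=
              (norm_sum_le _ _).trans (Finset.sum_le_sum fun i _ => norm_inner_le_norm _ _)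
          _ ≤ ∑ i, (C * ‖h‖) * ‖φ (star (b i)) h‖ :=
              Finset.sum_le_sum fun i _ => mul_le_mul_of_nonneg_right
                ((norm_le_pi_norm g i).trans hgn) (norm_nonneg _)
          _ = ‖h‖ * (C * ∑ i, ‖φ (star (b i)) h‖) := by
              rw [← Finset.mul_sum]; ring
      exact le_of_mul_le_mul_left h1 hpos
    -- Chosen so that C n ε < 1. A bump at x supported where every |b_i| < ε has norm at least 1,
    -- while `hbelow` bounds it by C n ε.
    set ε : ℝ := 1 / (2 * (C * (n + 1))) with hε
    have hn : (0 : ℝ) < (n : ℝ) + 1 := by positivity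
    have hεpos : 0 < ε := by positivity
    have hUo : IsOpen {y : characterSpace ℂ A | ∀ i, ‖y (b i)‖ < ε} := by
      rw [Set.ofPred_forall]
      exact isOpen_iInter_of_finite fun i =>
        isOpen_lt (continuous_character_apply (b i)).norm continuous_const
    obtain ⟨e, he1, he0, hele⟩ := exists_bump hUo (x := x) fun i => by rw [hb0, norm_zero]; exact hεpos
    have hsmall : ∀ i, ‖star (b i) * e‖ ≤ ε := by
      intro i
      refine norm_le_of_forall_character hεpos.le fun y => ?_
      rw [map_mul, norm_mul, map_star, norm_star]
      by_cases hy : y ∈ {y : characterSpace ℂ A | ∀ i, ‖y (b i)‖ < ε}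
      · calc ‖y (b i)‖ * ‖y e‖ ≤ ε * 1 :=
            mul_le_mul (hy i).le (hele y) (norm_nonneg _) hεpos.le
          _ = ε := mul_one ε
      · rw [he0 y hy, norm_zero, mul_zero]; exact hεpos.le
    have hφn : ∀ a : A, ‖φ a‖ = ‖a‖ := (AddMonoidHomClass.isometry_iff_norm φ).1 hφ
    have hen : ‖φ e‖ ≤ C * (n * ε) := by
      refine ContinuousLinearMap.opNorm_le_bound _ (by positivity) fun h => ?_
      refine (hbelow _).trans ?_
      rw [mul_assoc]
      refine mul_le_mul_of_nonneg_left ?_ hC.le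
      calc ∑ i, ‖φ (star (b i)) (φ e h)‖ ≤ ∑ _i : Fin n, ε * ‖h‖ := by
            refine Finset.sum_le_sum fun i _ => ?_
            have : φ (star (b i)) (φ e h) = φ (star (b i) * e) h := by rw [map_mul]; rfl
            rw [this]
            refine (ContinuousLinearMap.le_opNorm _ _).trans ?_
            rw [hφn]
            exact mul_le_mul_of_nonneg_right (hsmall i) (norm_nonneg _)
        _ = n * ε * ‖h‖ := by simp [mul_assoc]
    have h1e : 1 ≤ ‖φ e‖ := by
      rw [hφn]
      have := norm_character_le e x
      rwa [he1, norm_one] at this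
    have h3 : C * (n * ε) < 1 := by
      rw [hε]
      field_simp
      linarith
    linarith

/-- A tuple in a commutative C⋆-algebra has any compact set containing its joint spectrum as a
spectral set. -/
theorem isSpectralSet_of_character_mem {A : Type*} [CommCStarAlgebra A] (φ : A →⋆ₐ[ℂ] (H →L[ℂ] H))
    (hφ : Isometry φ) {n : ℕ} (a : Fin n → A) {X : Set (Fin n → ℂ)} (hX : IsCompact X)
    (h : ∀ x : characterSpace ℂ A, (fun i => x (a i)) ∈ X) :
    IsSpectralSet X (fun i => φ (a i)) := by
  refine ⟨?_, fun p q hq => ?_⟩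
  · rw [taylorSpectrum_eq_range φ hφ]
    rintro _ ⟨x, rfl⟩
    exact h x
  have hop : ∀ r, opEval (fun i => φ (a i)) r = φ (MvPolynomial.aeval a r) :=
    fun r => opEval_map φ.toAlgHom a r
  have hu : IsUnit (MvPolynomial.aeval a q) :=
    isUnit_of_forall_character_ne_zero fun x => by rw [character_aeval]; exact hq _ (h x)
  obtain ⟨u, hu'⟩ := hu
  have hinv : Ring.inverse (opEval (fun i => φ (a i)) q) = φ (↑u⁻¹ : A) := by
    rw [hop, ← hu']
    exact Ring.inverse_unit (Units.map (φ : A →* (H →L[ℂ] H)) u)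
  refine ⟨by rw [hop, ← hu']; exact u.isUnit.map φ, ?_⟩
  rw [hinv, hop, ← map_mul, (AddMonoidHomClass.isometry_iff_norm φ).1 hφ]
  -- Needed because the supremum of an unbounded real family is 0 by convention.
  have hbdd : BddAbove (Set.range fun x : X =>
      ‖MvPolynomial.eval (x : Fin n → ℂ) p / MvPolynomial.eval (x : Fin n → ℂ) q‖) := by
    have : CompactSpace X := isCompact_iff_compactSpace.1 hX
    refine (isCompact_range (X := X)
      (Continuous.norm (Continuous.div ?_ ?_ fun x => hq x x.2))).bddAbove
    · exact (MvPolynomial.continuous_eval p).comp continuous_subtype_val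
    · exact (MvPolynomial.continuous_eval q).comp continuous_subtype_val
  refine norm_le_of_forall_character (Real.iSup_nonneg fun _ => norm_nonneg _) fun x => ?_
  have hxu : x (↑u⁻¹ : A) = (MvPolynomial.eval (fun i => x (a i)) q)⁻¹ := by
    rw [← character_aeval, ← hu']
    refine eq_inv_of_mul_eq_one_left ?_
    rw [← map_mul, Units.inv_mul, map_one]
  rw [map_mul, hxu, character_aeval, ← div_eq_mul_inv]
  exact le_ciSup hbdd ⟨_, h x⟩

end Koszul

/-! ### From operators to characters, and the implications. -/

section Main

universe u

variable {H : Type u} [NormedAddCommGroup H] [InnerProductSpace ℂ H]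

theorem tuple_castSucc {m : ℕ} (S : Fin m → H →L[ℂ] H) (P : H →L[ℂ] H) (i : Fin m) :
    tuple S P i.castSucc = S i :=
  Fin.snoc_castSucc (α := fun _ => H →L[ℂ] H) P S i

theorem tuple_last {m : ℕ} (S : Fin m → H →L[ℂ] H) (P : H →L[ℂ] H) :
    tuple S P (Fin.last m) = P :=
  Fin.snoc_last (α := fun _ => H →L[ℂ] H) P S

/-- For a commuting tuple, `p ↦ p(T)` is an algebra homomorphism. -/
theorem IsCommuting.exists_algHom {n : ℕ} {T : Fin n → H →L[ℂ] H} (hT : IsCommuting T) :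
    ∃ ψ : MvPolynomial (Fin n) ℂ →ₐ[ℂ] (H →L[ℂ] H),
      (∀ i, ψ (MvPolynomial.X i) = T i) ∧ ∀ p, opEval T p = ψ p := by
  have hcomm : IsMulCommutative (Algebra.adjoin ℂ (Set.range T)) :=
    Algebra.isMulCommutative_adjoin ℂ (by
      rintro _ ⟨i, rfl⟩ _ ⟨j, rfl⟩
      exact hT i j)
  let : CommRing (Algebra.adjoin ℂ (Set.range T)) :=
    { (inferInstance : Ring (Algebra.adjoin ℂ (Set.range T))) with
      mul_comm := hcomm.is_comm.comm }
  let t : Fin n → Algebra.adjoin ℂ (Set.range T) := fun i =>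
    ⟨T i, Algebra.subset_adjoin ⟨i, rfl⟩⟩
  refine ⟨(Algebra.adjoin ℂ (Set.range T)).val.comp (MvPolynomial.aeval t), fun i => ?_, fun p => ?_⟩
  · simp [t]
  · exact opEval_map (Algebra.adjoin ℂ (Set.range T)).val t p

theorem norm_apply_le_of_gamContraction {m : ℕ} {S : Fin m → H →L[ℂ] H} {P : H →L[ℂ] H}
    (hT : IsGamContraction (tuple S P)) (i : Fin m) {c : ℝ} {α : ℂ} (hα : ‖α‖ = 1)
    (hc : ∀ x ∈ Gam (m + 1), ‖x i.castSucc‖ < c) (h : H) :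
    ‖((c : ℂ) * α) • P h - S i.rev h‖ ≤ ‖(c : ℂ) • h - α • S i h‖ := by
  obtain ⟨ψ, hψX, hψ⟩ := hT.commuting.exists_algHom
  set p : MvPolynomial (Fin (m + 1)) ℂ :=
    ((c : ℂ) * α) • MvPolynomial.X (Fin.last m) - MvPolynomial.X i.rev.castSucc with hp
  set q : MvPolynomial (Fin (m + 1)) ℂ :=
    MvPolynomial.C (c : ℂ) - α • MvPolynomial.X i.castSucc with hq
  have hpe : ∀ x, MvPolynomial.eval x p = c * α * x (Fin.last m) - x i.rev.castSucc := by
    intro x; simp [hp]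
  have hqe : ∀ x, MvPolynomial.eval x q = c - α * x i.castSucc := by
    intro x; simp [hq]
  have hpo : opEval (tuple S P) p = ((c : ℂ) * α) • P - S i.rev := by
    rw [hψ, hp, map_sub, map_smul, hψX, hψX, tuple_last, tuple_castSucc]
  have hqo : opEval (tuple S P) q = (c : ℂ) • 1 - α • S i := by
    rw [hψ, hq, map_sub, map_smul, hψX, tuple_castSucc, ← MvPolynomial.algebraMap_eq,
      AlgHom.commutes, Algebra.algebraMap_eq_smul_one]
  obtain ⟨hu, hle⟩ := hT.spectralSet.norm_le p q fun x hx => by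
    rw [hqe]; exact (norm_div_le_one_of_mem_Gam i c α hα hc hx).1
  have hle1 := hle.trans (Real.iSup_le (fun x => by
    rw [hpe, hqe]; exact (norm_div_le_one_of_mem_Gam i c α hα hc x.2).2) zero_le_one)
  have hQ : opEval (tuple S P) p =
      opEval (tuple S P) p * Ring.inverse (opEval (tuple S P) q) * opEval (tuple S P) q := by
    rw [mul_assoc, Ring.inverse_mul_cancel _ hu, mul_one]
  have hfin : ‖opEval (tuple S P) p h‖ ≤ ‖opEval (tuple S P) q h‖ := by
    conv_lhs => rw [hQ]
    change ‖(opEval (tuple S P) p * Ring.inverse (opEval (tuple S P) q))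
      (opEval (tuple S P) q h)‖ ≤ _
    refine (ContinuousLinearMap.le_opNorm _ _).trans ?_
    exact (mul_le_mul_of_nonneg_right hle1 (norm_nonneg _)).trans_eq (one_mul _)
  rw [hpo, hqo] at hfin
  exact hfin

variable [CompleteSpace H]

theorem exists_rep_of_isStarNormal {n : ℕ} {T : Fin n → H →L[ℂ] H} (hT : IsCommuting T)
    (hn : ∀ i, IsStarNormal (T i)) :
    ∃ (A : Type u) (_ : CommCStarAlgebra A) (φ : A →⋆ₐ[ℂ] (H →L[ℂ] H)) (a : Fin n → A),
      Isometry φ ∧ ExtremallyDisconnected (characterSpace ℂ A) ∧ (fun i => φ (a i)) = T := by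
  obtain ⟨A, _, φ, hφ, hr⟩ := exists_commCStarAlgebra (W := Set.range T) (by
    rintro _ ⟨i, rfl⟩ _ ⟨j, rfl⟩
    -- Fuglede's theorem.
    exact ⟨hT i j, (hn j).commute_star_right (hT i j)⟩)
  choose a ha using fun i => (hr (T i)).1 (subset_bicommutant _ ⟨i, rfl⟩)
  exact ⟨A, _, φ, a, hφ, extremallyDisconnected_characterSpace φ hφ hr, funext ha⟩

section Characters

variable {A : Type*} [CommCStarAlgebra A] (φ : A →⋆ₐ[ℂ] (H →L[ℂ] H))

theorem isGamUnitary_of_character_mem (hφ : Isometry φ) {n : ℕ} (a : Fin n → A)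
    (h : ∀ x : characterSpace ℂ A, (fun i => x (a i)) ∈ bGam n) :
    IsGamUnitary fun i => φ (a i) where
  commuting i j := (Commute.all (a i) (a j)).map φ
  normal i := ⟨by rw [← map_star]; exact (Commute.all (star (a i)) (a i)).map φ⟩
  spectrum_subset := by
    rw [taylorSpectrum_eq_range φ hφ]
    rintro _ ⟨x, rfl⟩
    exact h x

theorem isGamContraction_of_character_mem (hφ : Isometry φ) {n : ℕ} (a : Fin n → A)
    (h : ∀ x : characterSpace ℂ A, (fun i => x (a i)) ∈ Gam n) :
    IsGamContraction fun i => φ (a i) where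
  commuting i j := (Commute.all (a i) (a j)).map φ
  spectralSet := isSpectralSet_of_character_mem φ hφ a (isCompact_Gam n) h

theorem character_mem_of_taylorSpectrum_subset (hφ : Isometry φ) {n : ℕ} (a : Fin n → A)
    {X : Set (Fin n → ℂ)} (h : taylorSpectrum (fun i => φ (a i)) ⊆ X)
    (x : characterSpace ℂ A) : (fun i => x (a i)) ∈ X := by
  rw [taylorSpectrum_eq_range φ hφ] at h
  exact h ⟨x, rfl⟩

theorem mem_unitary_iff_norm_character (hφ : Isometry φ) (a : A) :
    φ a ∈ unitary (H →L[ℂ] H) ↔ ∀ x : characterSpace ℂ A, ‖x a‖ = 1 := by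
  have key : star a * a = 1 ↔ ∀ x : characterSpace ℂ A, ‖x a‖ = 1 := by
    have hx : ∀ x : characterSpace ℂ A, x (star a * a) = ((‖x a‖ ^ 2 : ℝ) : ℂ) := by
      intro x
      rw [map_mul, map_star, mul_comm, Complex.star_def, Complex.mul_conj,
        Complex.normSq_eq_norm_sq]
    constructor
    · intro h x
      have h1 := hx x
      rw [h, map_one] at h1
      have h2 : ‖x a‖ ^ 2 = 1 := by exact_mod_cast h1.symm
      exact (pow_eq_one_iff_of_nonneg (norm_nonneg _) two_ne_zero).1 h2
    · intro h
      refine ext_character fun x => ?_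
      rw [hx, h, map_one]; norm_num
  rw [← key, Unitary.mem_iff, ← map_star, ← map_mul, ← map_mul, mul_comm a, and_self,
    ← map_one φ, hφ.injective.eq_iff]

end Characters

/-- The roots of the characteristic polynomial of a `Γ_n`-unitary can be chosen as commuting
unitaries, by projectivity of the spectrum of the bicommutant. -/
theorem IsGamUnitary.exists_unitary {n : ℕ} {T : Fin n → H →L[ℂ] H} (hT : IsGamUnitary T) :
    ∃ U : Fin n → H →L[ℂ] H,
      IsCommuting U ∧ (∀ i, U i ∈ unitary (H →L[ℂ] H)) ∧ T = opSymmMap U := by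
  obtain ⟨A, _, φ, a, hφ, _, rfl⟩ := exists_rep_of_isStarNormal hT.commuting hT.normal
  have hmem := character_mem_of_taylorSpectrum_subset φ hφ a hT.spectrum_subset
  have : CompactSpace {z : Fin n → ℂ | ∀ i, ‖z i‖ = 1} :=
    isCompact_iff_compactSpace.1 (isCompact_torus n)
  have : CompactSpace (bGam n) := isCompact_iff_compactSpace.1 (isCompact_bGam n)
  -- Projectivity requires all three spaces in one universe, hence the `ULift`.
  let f : characterSpace ℂ A → ULift.{u} (bGam n) := fun x => ⟨⟨fun i => x (a i), hmem x⟩⟩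
  let g : ULift.{u} {z : Fin n → ℂ | ∀ i, ‖z i‖ = 1} → ULift.{u} (bGam n) :=
    fun z => ⟨⟨symmMap n z.down, ⟨z.down, z.down.2, rfl⟩⟩⟩
  have hf : Continuous f := continuous_uliftUp.comp
    (Continuous.subtype_mk (continuous_pi fun i => continuous_character_apply (a i)) _)
  have hg : Continuous g := continuous_uliftUp.comp (Continuous.subtype_mk
    ((continuous_symmMap n).comp (continuous_subtype_val.comp continuous_uliftDown)) _)
  have hgs : Function.Surjective g := by
    rintro ⟨⟨_, ⟨z, hz, rfl⟩⟩⟩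
    exact ⟨⟨⟨z, hz⟩⟩, rfl⟩
  obtain ⟨k, hk, hgk⟩ := CompactT2.ExtremallyDisconnected.projective hf hg hgs
  have hkc : ∀ i, Continuous fun x => ((k x).down : Fin n → ℂ) i := fun i =>
    (continuous_apply i).comp (continuous_subtype_val.comp (continuous_uliftDown.comp hk))
  choose v hv using fun i => exists_forall_character_eq (A := A) ⟨_, hkc i⟩
  have hv : ∀ i (x : characterSpace ℂ A), x (v i) = ((k x).down : Fin n → ℂ) i := hv
  refine ⟨fun i => φ (v i), fun i j => (Commute.all (v i) (v j)).map φ, fun i => ?_, ?_⟩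
  · rw [mem_unitary_iff_norm_character φ hφ]
    intro x
    rw [hv]
    exact (k x).down.2 i
  · funext i
    refine Eq.trans ?_ (opEval_map φ.toAlgHom v _).symm
    refine congrArg φ (ext_character fun x => ?_)
    rw [character_aeval]
    simp only [hv]
    exact (congrFun (congrArg (fun y : ULift.{u} (bGam n) => (y.down : Fin n → ℂ))
      (congrFun hgk x)) i).symm

theorem exists_gamUnitary_of_unitary {m : ℕ} {S : Fin m → H →L[ℂ] H} {P : H →L[ℂ] H}
    {U : Fin (m + 1) → H →L[ℂ] H} (hU : IsCommuting U) (hu : ∀ i, U i ∈ unitary (H →L[ℂ] H))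
    (hSP : tuple S P = opSymmMap U) :
    P ∈ unitary (H →L[ℂ] H) ∧ ∃ C : Fin m → H →L[ℂ] H, IsGamUnitary C ∧
      (∀ i, Commute (C i) P) ∧ ∀ i, S i = C i + star (C i.rev) * P := by
  obtain ⟨A, _, φ, a, hφ, -, rfl⟩ := exists_rep_of_isStarNormal hU
    fun i => ⟨((Unitary.mem_iff.1 (hu i)).1.trans (Unitary.mem_iff.1 (hu i)).2.symm)⟩
  simp only [mem_unitary_iff_norm_character φ hφ] at hu
  have hT : ∀ i : Fin (m + 1), tuple S P i =
      φ (MvPolynomial.aeval a (MvPolynomial.esymm (Fin (m + 1)) ℂ ((i : ℕ) + 1))) := by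
    intro i
    rw [hSP]
    exact opEval_map φ.toAlgHom a _
  set s : Fin (m + 1) → A := fun i =>
    MvPolynomial.aeval a (MvPolynomial.esymm (Fin (m + 1)) ℂ ((i : ℕ) + 1)) with hs
  have hsx : ∀ (x : characterSpace ℂ A) i, x (s i) = symmMap (m + 1) (fun i => x (a i)) i :=
    fun x i => character_aeval a _ x
  -- C is the symmetrization of all the unitaries but the last.
  set c : Fin m → A := fun i =>
    MvPolynomial.aeval (fun j : Fin m => a j.castSucc)
      (MvPolynomial.esymm (Fin m) ℂ ((i : ℕ) + 1)) with hc
  have hcx : ∀ (x : characterSpace ℂ A) i, x (c i) = symmMap m (fun j => x (a j.castSucc)) i :=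
    fun x i => character_aeval _ _ x
  have hP : P = φ (s (Fin.last m)) := by rw [← hT, tuple_last]
  have hS : ∀ i, S i = φ (s i.castSucc) := fun i => by rw [← hT, tuple_castSucc]
  have hz : ∀ x : characterSpace ℂ A, (fun i => x (a i)) =
      Fin.snoc (α := fun _ => ℂ) (fun j : Fin m => x (a j.castSucc)) (x (a (Fin.last m))) :=
    fun x => (Fin.snoc_init_self (α := fun _ => ℂ) fun i => x (a i)).symm
  refine ⟨?_, fun i => φ (c i), ?_, fun i => ?_, fun i => ?_⟩
  · rw [hP, mem_unitary_iff_norm_character φ hφ]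
    intro x
    rw [hsx]
    exact norm_last_bGam ⟨_, fun i => hu i x, rfl⟩
  · refine isGamUnitary_of_character_mem φ hφ c fun x => ?_
    exact ⟨fun j => x (a j.castSucc), fun j => hu _ x, (funext (hcx x)).symm⟩
  · rw [hP]; exact (Commute.all (c i) _).map φ
  · rw [hP, hS, ← map_star, ← map_mul, ← map_add]
    refine congrArg φ (ext_character fun x => ?_)
    rw [map_add, map_mul, map_star, hsx, hsx, hcx, hcx, hz,
      symmMap_snoc_castSucc m _ (fun j => hu _ x), symmMap_snoc_last]
    rfl

theorem isGamUnitary_of_exists_gamUnitary {m : ℕ} {S C : Fin m → H →L[ℂ] H} {P : H →L[ℂ] H}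
    (hP : P ∈ unitary (H →L[ℂ] H)) (hC : IsGamUnitary C) (hCP : ∀ i, Commute (C i) P)
    (hS : ∀ i, S i = C i + star (C i.rev) * P) : IsGamUnitary (tuple S P) := by
  have hcomm : IsCommuting (tuple C P) := by
    intro i j
    induction i using Fin.lastCases with
    | last =>
      induction j using Fin.lastCases with
      | last => exact Commute.refl _
      | cast j => rw [tuple_last, tuple_castSucc]; exact (hCP j).symm
    | cast i =>
      induction j using Fin.lastCases with
      | last => rw [tuple_last, tuple_castSucc]; exact hCP i
      | cast j => rw [tuple_castSucc, tuple_castSucc]; exact hC.commuting i j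
  have hnormal : ∀ i, IsStarNormal (tuple C P i) := by
    intro i
    induction i using Fin.lastCases with
    | last =>
      rw [tuple_last]
      exact ⟨(Unitary.mem_iff.1 hP).1.trans (Unitary.mem_iff.1 hP).2.symm⟩
    | cast i => rw [tuple_castSucc]; exact hC.normal i
  obtain ⟨A, _, φ, a, hφ, -, ha⟩ := exists_rep_of_isStarNormal hcomm hnormal
  have haC : ∀ i : Fin m, C i = φ (a i.castSucc) := fun i => by
    rw [← tuple_castSucc C P i, ← ha]
  have haP : P = φ (a (Fin.last m)) := by
    conv_lhs => rw [← tuple_last C P, ← ha]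
  obtain rfl : C = fun i => φ (a i.castSucc) := funext haC
  have hmem := character_mem_of_taylorSpectrum_subset φ hφ _ hC.spectrum_subset
  rw [haP, mem_unitary_iff_norm_character φ hφ] at hP
  set s : Fin (m + 1) → A := Fin.snoc (α := fun _ => A)
    (fun i : Fin m => a i.castSucc + star (a i.rev.castSucc) * a (Fin.last m))
    (a (Fin.last m)) with hs
  have hs1 : ∀ i : Fin m, s i.castSucc =
      a i.castSucc + star (a i.rev.castSucc) * a (Fin.last m) :=
    fun i => Fin.snoc_castSucc (α := fun _ => A) _ _ i
  have hs2 : s (Fin.last m) = a (Fin.last m) := Fin.snoc_last (α := fun _ => A) _ _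
  have hT : tuple S P = fun i => φ (s i) := by
    funext i
    induction i using Fin.lastCases with
    | last => rw [tuple_last, hs2, haP]
    | cast i => rw [tuple_castSucc, hs1, hS, haP, map_add, map_mul, map_star]
  rw [hT]
  refine isGamUnitary_of_character_mem φ hφ s fun x => ?_
  obtain ⟨z, hz, hzx⟩ := hmem x
  have hz : ∀ i, ‖z i‖ = 1 := hz
  have hzx : ∀ i : Fin m, symmMap m z i = x (a i.castSucc) := fun i => congrFun hzx i
  have hprod : ‖∏ j, z j‖ = 1 := by
    rw [norm_prod]; exact Finset.prod_eq_one fun i _ => hz i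
  have hlast : (∏ j, z j) * ((starRingEnd ℂ) (∏ j, z j) * x (a (Fin.last m))) =
      x (a (Fin.last m)) := by
    rw [← mul_assoc, mul_comm (∏ j, z j), conj_mul_self_of_norm_eq_one hprod, one_mul]
  -- The missing root is p / ∏ z_j, so that all the roots multiply to p. No continuity in x is
  -- needed here.
  refine ⟨Fin.snoc z ((starRingEnd ℂ) (∏ j, z j) * x (a (Fin.last m))), fun i => ?_, ?_⟩
  · induction i using Fin.lastCases with
    | last =>
      rw [Fin.snoc_last, norm_mul, RCLike.norm_conj, hprod, hP x, one_mul]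
    | cast i => rw [Fin.snoc_castSucc]; exact hz i
  · funext i
    induction i using Fin.lastCases with
    | last => rw [symmMap_snoc_last, hlast, hs2]
    | cast i =>
      rw [symmMap_snoc_castSucc m z hz, hlast, hs1, map_add, map_mul, map_star, hzx, hzx]
      rfl

theorem IsGamUnitary.structure {m : ℕ} {S : Fin m → H →L[ℂ] H} {P : H →L[ℂ] H}
    (h : IsGamUnitary (tuple S P)) :
    P ∈ unitary (H →L[ℂ] H) ∧ (∀ i, S i = star (S i.rev) * P) ∧
      IsGamContraction (fun i : Fin m => (((m : ℂ) - ((i : ℕ) : ℂ)) / ((m : ℂ) + 1)) • S i) ∧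
      IsGamContraction (tuple S P) := by
  obtain ⟨A, _, φ, a, hφ, -, ha⟩ := exists_rep_of_isStarNormal h.commuting h.normal
  have hS : S = fun i => φ (a i.castSucc) := funext fun i => by
    rw [← tuple_castSucc S P i, ← ha]
  have hP : P = φ (a (Fin.last m)) := by
    conv_lhs => rw [← tuple_last S P, ← ha]
  have hsp := h.spectrum_subset
  rw [← ha] at hsp
  have hmem := character_mem_of_taylorSpectrum_subset φ hφ a hsp
  refine ⟨?_, fun i => ?_, ?_, ?_⟩
  · rw [hP, mem_unitary_iff_norm_character φ hφ]
    exact fun x => norm_last_bGam (hmem x)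
  · rw [hP, hS, ← map_star, ← map_mul]
    refine congrArg φ (ext_character fun x => ?_)
    rw [map_mul, map_star]
    exact bGam_castSucc (hmem x) i
  · have : (fun i : Fin m => (((m : ℂ) - ((i : ℕ) : ℂ)) / ((m : ℂ) + 1)) • S i) =
        fun i : Fin m => φ ((((m : ℂ) - ((i : ℕ) : ℂ)) / ((m : ℂ) + 1)) • a i.castSucc) := by
      funext i; rw [map_smul, hS]
    rw [this]
    refine isGamContraction_of_character_mem φ hφ _ fun x => ?_
    have := derivTuple_mem_Gam (bGam_subset_Gam _ (hmem x))
    convert this using 1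
    funext i
    rw [map_smul]; rfl
  · rw [← ha]
    exact isGamContraction_of_character_mem φ hφ a fun x => bGam_subset_Gam _ (hmem x)

/-- Since S_i^* = P^* S_{n-i}, and S_i commutes with S_{n-i} and with P, hence with P^*, it commutes
with its adjoint. -/
theorem isStarNormal_tuple {m : ℕ} {S : Fin m → H →L[ℂ] H} {P : H →L[ℂ] H}
    (hcomm : IsCommuting (tuple S P)) (hP : P ∈ unitary (H →L[ℂ] H))
    (hS : ∀ i, S i = star (S i.rev) * P) (i : Fin (m + 1)) : IsStarNormal (tuple S P i) := by
  have hPn : IsStarNormal P := ⟨(Unitary.mem_iff.1 hP).1.trans (Unitary.mem_iff.1 hP).2.symm⟩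
  induction i using Fin.lastCases with
  | last => rw [tuple_last]; exact hPn
  | cast i =>
    rw [tuple_castSucc]
    have h1 : Commute (S i) (S i.rev) := by
      simpa only [tuple_castSucc] using hcomm i.castSucc i.rev.castSucc
    have h2 : Commute (S i) P := by
      simpa only [tuple_castSucc, tuple_last] using hcomm i.castSucc (Fin.last m)
    have h3 : star (S i) = star P * S i.rev := by rw [hS i, star_mul, star_star]
    exact ⟨by rw [h3]; exact ((hPn.commute_star_right h2).mul_right h1).symm⟩

/-- If `P` is unitary and `S_i = S_{n-i}^* P`, being a `Γ_n`-unitary can be tested on characters. -/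
theorem isGamUnitary_tuple_of_character {m : ℕ} {S : Fin m → H →L[ℂ] H} {P : H →L[ℂ] H}
    (hcomm : IsCommuting (tuple S P)) (hP : P ∈ unitary (H →L[ℂ] H))
    (hS : ∀ i, S i = star (S i.rev) * P)
    (h : ∀ (A : Type u) [CommCStarAlgebra A] (φ : A →⋆ₐ[ℂ] (H →L[ℂ] H)) (a : Fin (m + 1) → A)
      (x : characterSpace ℂ A), Isometry φ → (fun i => φ (a i)) = tuple S P →
      ‖x (a (Fin.last m))‖ = 1 →
      (∀ i : Fin m, x (a i.castSucc) =
        (starRingEnd ℂ) (x (a i.rev.castSucc)) * x (a (Fin.last m))) →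
      (fun i => x (a i)) ∈ bGam (m + 1)) : IsGamUnitary (tuple S P) := by
  obtain ⟨A, _, φ, a, hφ, -, ha⟩ := exists_rep_of_isStarNormal hcomm
    (isStarNormal_tuple hcomm hP hS)
  have hSa : ∀ i, S i = φ (a i.castSucc) := fun i => by rw [← tuple_castSucc S P i, ← ha]
  have hPa : P = φ (a (Fin.last m)) := by
    conv_lhs => rw [← tuple_last S P, ← ha]
  rw [← ha]
  refine isGamUnitary_of_character_mem φ hφ a fun x => h A φ a x hφ ha ?_ fun i => ?_
  · rw [hPa] at hP
    exact (mem_unitary_iff_norm_character φ hφ _).1 hP x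
  · have h1 := hS i
    rw [hSa, hSa, hPa, ← map_star, ← map_mul] at h1
    have h2 := congrArg x (hφ.injective h1)
    rwa [map_mul, map_star] at h2

theorem isGamUnitary_of_deriv_contraction {m : ℕ} {S : Fin m → H →L[ℂ] H} {P : H →L[ℂ] H}
    (hcomm : IsCommuting (tuple S P)) (hP : P ∈ unitary (H →L[ℂ] H))
    (hS : ∀ i, S i = star (S i.rev) * P)
    (hd : IsGamContraction
      (fun i : Fin m => (((m : ℂ) - ((i : ℕ) : ℂ)) / ((m : ℂ) + 1)) • S i)) :
    IsGamUnitary (tuple S P) := by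
  refine isGamUnitary_tuple_of_character hcomm hP hS fun A _ φ a x hφ ha h1 h2 => ?_
  refine mem_bGam_of_derivTuple_mem_Gam h2 h1 ?_
  have hsp := hd.spectralSet.spectrum_subset
  have : (fun i : Fin m => (((m : ℂ) - ((i : ℕ) : ℂ)) / ((m : ℂ) + 1)) • S i) =
      fun i : Fin m => φ ((((m : ℂ) - ((i : ℕ) : ℂ)) / ((m : ℂ) + 1)) • a i.castSucc) := by
    funext i; rw [map_smul, ← tuple_castSucc S P i, ← ha]
  rw [this] at hsp
  have := character_mem_of_taylorSpectrum_subset φ hφ _ hsp x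
  convert this using 1
  funext i
  rw [map_smul]; rfl

/-! ### Γ_n-contractions with unitary last entry. -/

/-- Square `norm_apply_le_of_gamContraction`; as P is isometric, the terms c²‖h‖² cancel. -/
theorem re_inner_le_of_gamContraction {m : ℕ} {S : Fin m → H →L[ℂ] H} {P : H →L[ℂ] H}
    (hT : IsGamContraction (tuple S P)) (hP : P ∈ unitary (H →L[ℂ] H)) (i : Fin m) {c : ℝ} {α : ℂ}
    (hα : ‖α‖ = 1) (hc : ∀ x ∈ Gam (m + 1), ‖x i.castSucc‖ < c) (h : H) :
    ‖S i.rev h‖ ^ 2 + 2 * c * (α * inner ℂ h (S i h)).re ≤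
      ‖S i h‖ ^ 2 + 2 * c * ((starRingEnd ℂ) α * inner ℂ (P h) (S i.rev h)).re := by
  have hle := norm_apply_le_of_gamContraction hT i hα hc h
  have hsq := pow_le_pow_left₀ (norm_nonneg _) hle 2
  have hPh : ‖P h‖ = ‖h‖ := by
    have h1 : inner ℂ (P h) (P h) = inner ℂ h h := by
      rw [← ContinuousLinearMap.adjoint_inner_right, ← ContinuousLinearMap.star_eq_adjoint]
      have h2 := congrArg (fun R : H →L[ℂ] H => R h) (Unitary.mem_iff.1 hP).1
      have h2 : (star P) (P h) = h := h2
      rw [h2]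
    rw [inner_self_eq_norm_sq_to_K, inner_self_eq_norm_sq_to_K] at h1
    have h3 : ‖P h‖ ^ 2 = ‖h‖ ^ 2 := by exact_mod_cast h1
    exact (sq_eq_sq₀ (norm_nonneg _) (norm_nonneg _)).1 h3
  rw [norm_sub_sq (𝕜 := ℂ), norm_sub_sq (𝕜 := ℂ), inner_smul_left, inner_smul_left,
    inner_smul_right, norm_smul, norm_smul, norm_smul, norm_mul, hα, hPh,
    map_mul (starRingEnd ℂ), Complex.conj_ofReal] at hsq
  have e1 : RCLike.re ((c : ℂ) * (starRingEnd ℂ) α * inner ℂ (P h) (S i.rev h)) =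
      c * ((starRingEnd ℂ) α * inner ℂ (P h) (S i.rev h)).re := by
    rw [mul_assoc]; exact Complex.re_ofReal_mul _ _
  have e2 : RCLike.re ((c : ℂ) * (α * inner ℂ h (S i h))) =
      c * (α * inner ℂ h (S i h)).re := Complex.re_ofReal_mul _ _
  rw [e1, e2] at hsq
  simp only [mul_one, one_mul] at hsq
  linarith

theorem eq_star_rev_mul_of_gamContraction {m : ℕ} {S : Fin m → H →L[ℂ] H} {P : H →L[ℂ] H}
    (hT : IsGamContraction (tuple S P)) (hP : P ∈ unitary (H →L[ℂ] H)) (i : Fin m) :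
    S i = star (S i.rev) * P := by
  obtain ⟨c, hc0, hc⟩ : ∃ c : ℝ, 0 < c ∧ ∀ x ∈ Gam (m + 1), ∀ j, ‖x j‖ < c := by
    obtain ⟨C, hC0, hC⟩ := (isCompact_Gam (m + 1)).isBounded.exists_pos_norm_le
    exact ⟨C + 1, by linarith, fun x hx j => by linarith [norm_le_pi_norm x j, hC x hx]⟩
  -- Adding the cases α = 1 and α = -1 removes the inner products. Applied to i and to its reversal,
  -- this gives equal norms, so only the inner products remain in `hre`.
  have hle : ∀ (j : Fin m) (h : H), ‖S j.rev h‖ ^ 2 ≤ ‖S j h‖ ^ 2 := by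
    intro j h
    have h1 := re_inner_le_of_gamContraction hT hP j (α := 1) (by simp) (fun x hx => hc x hx _) h
    have h2 := re_inner_le_of_gamContraction hT hP j (α := -1) (by simp) (fun x hx => hc x hx _) h
    simp only [map_neg, map_one, one_mul, neg_mul, Complex.neg_re] at h1 h2
    linarith
  have heq : ∀ h : H, ‖S i.rev h‖ ^ 2 = ‖S i h‖ ^ 2 := by
    intro h
    refine le_antisymm (hle i h) ?_
    have := hle i.rev h
    rwa [Fin.rev_rev] at this
  have hre : ∀ (α : ℂ), ‖α‖ = 1 → ∀ h : H, (α * inner ℂ h (S i h)).re ≤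
      ((starRingEnd ℂ) α * inner ℂ (P h) (S i.rev h)).re := by
    intro α hα h
    have h1 := re_inner_le_of_gamContraction hT hP i hα (fun x hx => hc x hx _) h
    rw [heq] at h1
    have h2 : c * (α * inner ℂ h (S i h)).re ≤
      c * ((starRingEnd ℂ) α * inner ℂ (P h) (S i.rev h)).re := by linarith
    exact le_of_mul_le_mul_left h2 hc0
  refine (ContinuousLinearMap.coe_injective ?_)
  rw [← ext_inner_map]
  intro h
  -- α = ±1 equates real parts and α = ±i imaginary parts, giving ⟨S_i h, h⟩ = ⟨P h, S_{n-i} h⟩;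
  -- over ℂ these quadratic forms determine the operators.
  have h1 := hre 1 (by simp) h
  have h2 := hre (-1) (by simp) h
  have h3 := hre Complex.I (by simp) h
  have h4 := hre (-Complex.I) (by simp) h
  simp at h1 h2 h3 h4
  change inner ℂ (S i h) h = inner ℂ ((star (S i.rev)) (P h)) h
  rw [ContinuousLinearMap.star_eq_adjoint, ContinuousLinearMap.adjoint_inner_left,
    ← inner_conj_symm]
  apply Complex.ext
  · rw [Complex.conj_re]; linarith
  · rw [Complex.conj_im]; linarith

theorem isGamUnitary_of_gamContraction {m : ℕ} {S : Fin m → H →L[ℂ] H} {P : H →L[ℂ] H}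
    (hT : IsGamContraction (tuple S P)) (hP : P ∈ unitary (H →L[ℂ] H)) :
    IsGamUnitary (tuple S P) := by
  refine isGamUnitary_tuple_of_character hT.commuting hP (eq_star_rev_mul_of_gamContraction hT hP)
    fun A _ φ a x hφ ha h1 _ => ?_
  have hsp := hT.spectralSet.spectrum_subset
  rw [← ha] at hsp
  exact mem_bGam_of_mem_Gam (character_mem_of_taylorSpectrum_subset φ hφ a hsp x) h1

end Main

end SymPolydisc

end

/-- Here `n = m + 1 ≥ 2`. The operator `S_i`, `1 ≤ i ≤ n - 1 = m`, is `S` at the zero-based index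
`i - 1`; hence `S_{n-i}` is `S` at the reversed index, and at the zero-based index `i` the factor
`(n - (i + 1)) / n` reads `(m - i) / (m + 1)`. -/
theorem mainTheorem4 {H : Type*} [NormedAddCommGroup H] [InnerProductSpace ℂ H] [CompleteSpace H]
    (m : ℕ) (hm : 1 ≤ m) (S : Fin m → H →L[ℂ] H) (P : H →L[ℂ] H)
    (hcomm : SymPolydisc.IsCommuting (SymPolydisc.tuple S P)) :
    List.TFAE [
      SymPolydisc.IsGamUnitary (SymPolydisc.tuple S P),
      ∃ U : Fin (m + 1) → H →L[ℂ] H,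
        SymPolydisc.IsCommuting U ∧ (∀ i, U i ∈ unitary (H →L[ℂ] H)) ∧
          SymPolydisc.tuple S P = SymPolydisc.opSymmMap U,
      P ∈ unitary (H →L[ℂ] H) ∧ (∀ i, S i = star (S i.rev) * P) ∧
        SymPolydisc.IsGamContraction
          (fun i : Fin m => (((m : ℂ) - ((i : ℕ) : ℂ)) / ((m : ℂ) + 1)) • S i),
      SymPolydisc.IsGamContraction (SymPolydisc.tuple S P) ∧ P ∈ unitary (H →L[ℂ] H),
      P ∈ unitary (H →L[ℂ] H) ∧
        ∃ C : Fin m → H →L[ℂ] H,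
          SymPolydisc.IsGamUnitary C ∧ (∀ i, Commute (C i) P) ∧
            ∀ i, S i = C i + star (C i.rev) * P] := by
  tfae_have 1 → 2 := SymPolydisc.IsGamUnitary.exists_unitary
  tfae_have 2 → 5 := fun ⟨_, hU, hu, h⟩ => SymPolydisc.exists_gamUnitary_of_unitary hU hu h
  tfae_have 5 → 1 := fun ⟨hP, _, hC, hCP, hS⟩ =>
    SymPolydisc.isGamUnitary_of_exists_gamUnitary hP hC hCP hS
  tfae_have 1 → 3 := fun h => ⟨h.structure.1, h.structure.2.1, h.structure.2.2.1⟩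
  tfae_have 3 → 1 := fun ⟨hP, hS, hd⟩ =>
    SymPolydisc.isGamUnitary_of_deriv_contraction hcomm hP hS hd
  tfae_have 1 → 4 := fun h => ⟨h.structure.2.2.2, h.structure.1⟩
  tfae_have 4 → 1 := fun ⟨hT, hP⟩ => SymPolydisc.isGamUnitary_of_gamContraction hT hP
  tfae_finish
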